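/- Let $m\ge 2$, and let $S_1,\dots,S_m$ be affine contractions of $[0,1]$ (with nonzero, possibly negative, ratios) onto subsegments $I_1,\dots,I_m$ of $[0,1]$ with pairwise disjoint interiors. Let $\rho_1,\dots,\rho_m>0$ with $\sum_i\rho_i=1$, and let $\mu_0$ be the corresponding self-similar measure, i.e. the unique Borel probability measure on $[0,1]$ with $\mu_0(E)=\sum_{i=1}^m\rho_i\,\mu_0(S_i^{-1}(E))$ for every Borel set $E$. Let $g:[0,1]\to[0,1]$ be a $W^1_\infty$ diffeomorphism, i.e. a homeomorphism of $[0,1]$ onto itself (increasing or decreasing) such that $g$ and $g^{-1}$ both belong to the Sobolev space $W^1_\infty[0,1]$. Let $\mu$ be the deformed self-similar measure $\mu(E)=\mu_0(g(E))$. For a finite Borel measure $\nu$ on $[0,1]$ a real number $s$ is an eigenvalue of the Neumann problem $-y''=s\,\nu\,y$, $y'(0)=y'(1)=0$, if there is a nonzero $y\in W^1_2[0,1]$ with $$\int_0^1 y'\eta'\,dx = s\int_0^1 y\,\eta\,d\nu\qquad\text{for all }\eta\in W^1_2[0,1],$$ and its multiplicity is the dimension of the space of all such $y$. Let $N(\lambda,\nu)$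 be the number of eigenvalues $s<\lambda$, counted with multiplicity. Then $N(\lambda,\mu_0)$ and $N(\lambda,\mu)$ are finite for every real $\lambda$, and there exist constants $C_1,C_2>0$ such that for all $\lambda\ge 0$ $$C_1\,N(\lambda,\mu_0)\le N(\lambda,\mu)\le C_2\,N(\lambda,\mu_0).$$ -/

import Mathlib

open MeasureTheory Set
open scoped ENNReal unitInterval

noncomputable section

/-- A finite family of affine contractions `S i : x ↦ ratio i * x + shift i` of `[0,1]` onto
nondegenerate subsegments of `[0,1]` with pairwise disjoint interiors, together with positive
weights of total sum one. The ratios may be negative (orientation reversing maps). -/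
structure AffineIFS (m : ℕ) where
  ratio : Fin m → ℝ
  shift : Fin m → ℝ
  weight : Fin m → ℝ
  ratio_ne_zero : ∀ i, ratio i ≠ 0
  abs_ratio_lt_one : ∀ i, |ratio i| < 1
  mapsTo : ∀ i, ∀ x ∈ Icc (0 : ℝ) 1, ratio i * x + shift i ∈ Icc (0 : ℝ) 1
  disjoint_interiors : ∀ i j, i ≠ j →
    Disjoint ((fun x : ℝ => ratio i * x + shift i) '' Ioo 0 1)
      ((fun x : ℝ => ratio j * x + shift j) '' Ioo 0 1)
  weight_pos : ∀ i, 0 < weight i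
  sum_weight : ∑ i, weight i = 1

/-- The contraction `S i` as a self-map of `[0,1]`. -/
def AffineIFS.S {m : ℕ} (F : AffineIFS m) (i : Fin m) (x : I) : I :=
  ⟨F.ratio i * (x : ℝ) + F.shift i, F.mapsTo i x x.2⟩

/-- The probability measure `μ₀` is the self-similar measure of the system, that is, the (unique)
Borel probability measure on `[0,1]` invariant under the weighted system in the sense of
Hutchinson. -/
def IsSelfSimilarMeasure {m : ℕ} (F : AffineIFS m) (μ₀ : Measure I) [IsProbabilityMeasure μ₀] :
    Prop :=
  ∀ E : Set I, MeasurableSet E →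
    μ₀ E = ∑ i, ENNReal.ofReal (F.weight i) * μ₀ (F.S i ⁻¹' E)

/-- `y` belongs to the Sobolev space `W^1_p[0,1]` (`1 ≤ p ≤ ∞`), with weak derivative `v`:
`y` is the absolutely continuous function with derivative `v ∈ L_p(0,1)`. -/
def HasSobolevDeriv (p : ℝ≥0∞) (y : I → ℝ) (v : ℝ → ℝ) : Prop :=
  MemLp v p (volume.restrict (Icc (0 : ℝ) 1)) ∧
    ∀ x : I, y x = y 0 + ∫ t in (0 : ℝ)..(x : ℝ), v t

/-- `y ∈ W^1_p[0,1]`. -/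
def MemSobolev (p : ℝ≥0∞) (y : I → ℝ) : Prop :=
  ∃ v, HasSobolevDeriv p y v

/-- `g` is a `W^1_∞` diffeomorphism of `[0,1]`: a bijection of `[0,1]` onto itself, continuous
together with its inverse, such that both `g` and `g⁻¹` belong to `W^1_∞[0,1]`. It may be
increasing or decreasing. -/
def IsSobolevDiffeo (g : I ≃ₜ I) : Prop :=
  MemSobolev ∞ (fun x => (g x : ℝ)) ∧ MemSobolev ∞ (fun x => (g.symm x : ℝ))

/-- The deformed measure `μ₀ ∘ g`, that is, `E ↦ μ₀ (g '' E)`. -/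
def deformedMeasure (μ₀ : Measure I) (g : I ≃ₜ I) : Measure I :=
  μ₀.map g.symm

instance (μ₀ : Measure I) [IsFiniteMeasure μ₀] (g : I ≃ₜ I) :
    IsFiniteMeasure (deformedMeasure μ₀ g) := by
  unfold deformedMeasure
  infer_instance

theorem deformedMeasure_apply (μ₀ : Measure I) (g : I ≃ₜ I) (E : Set I)
    (hE : MeasurableSet E) : deformedMeasure μ₀ g E = μ₀ (g '' E) := by
  rw [deformedMeasure, Measure.map_apply g.symm.continuous.measurable hE]
  congr 1
  exact (g.image_eq_preimage_symm E).symm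

/-- `y` is a generalized solution of `-y'' = lam μ y`, `y'(0) = y'(1) = 0`. -/
def IsNeumannSolution (μ : Measure I) (lam : ℝ) (y : I → ℝ) : Prop :=
  ∃ v, HasSobolevDeriv 2 y v ∧ ∀ η w, HasSobolevDeriv 2 η w →
    ∫ t in (0 : ℝ)..1, v t * w t = lam * ∫ x, y x * η x ∂μ

theorem HasSobolevDeriv.intervalIntegrable {p : ℝ≥0∞} (hp : 1 ≤ p) {y : I → ℝ} {v : ℝ → ℝ}
    (h : HasSobolevDeriv p y v) (x : I) :
    IntervalIntegrable v volume 0 (x : ℝ) := by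
  rw [intervalIntegrable_iff_integrableOn_Icc_of_le x.2.1]
  exact (show IntegrableOn v (Icc (0 : ℝ) 1) volume from h.1.integrable hp).mono_set
    (Icc_subset_Icc_right x.2.2)

theorem HasSobolevDeriv.continuous {p : ℝ≥0∞} (hp : 1 ≤ p) {y : I → ℝ} {v : ℝ → ℝ}
    (h : HasSobolevDeriv p y v) : Continuous y := by
  have h1 : IntegrableOn v (uIcc (0 : ℝ) 1) volume := by
    rw [uIcc_of_le zero_le_one]
    exact h.1.integrable hp
  have h2 := intervalIntegral.continuousOn_primitive_interval h1
  rw [uIcc_of_le zero_le_one] at h2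
  have h3 : y = fun x : I => y 0 + ∫ t in (0 : ℝ)..(x : ℝ), v t := funext h.2
  rw [h3]
  exact continuous_const.add (h2.comp_continuous continuous_subtype_val fun x => x.2)

theorem HasSobolevDeriv.integrable_mul {y η : I → ℝ} {v w : ℝ → ℝ} (μ : Measure I)
    [IsFiniteMeasure μ] (h : HasSobolevDeriv 2 y v) (k : HasSobolevDeriv 2 η w) :
    Integrable (fun x => y x * η x) μ :=
  ((h.continuous one_le_two).mul (k.continuous one_le_two)).integrable_of_hasCompactSupport
    (HasCompactSupport.of_compactSpace _)

theorem HasSobolevDeriv.intervalIntegrable_mul {y η : I → ℝ} {v w : ℝ → ℝ}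
    (h : HasSobolevDeriv 2 y v) (k : HasSobolevDeriv 2 η w) :
    IntervalIntegrable (fun t => v t * w t) volume 0 1 := by
  rw [intervalIntegrable_iff_integrableOn_Icc_of_le zero_le_one]
  exact h.1.integrable_mul k.1

/-- The space of generalized solutions for the spectral parameter `lam`; `lam` is an eigenvalue
if this space is nonzero, and its dimension is the multiplicity. -/
def eigenspace (μ : Measure I) [IsFiniteMeasure μ] (lam : ℝ) : Submodule ℝ (I → ℝ) where
  carrier := {y | IsNeumannSolution μ lam y}
  zero_mem' := ⟨0, ⟨MemLp.zero, by simp⟩, by simp⟩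
  add_mem' := by
    rintro y z ⟨v, hv, hy⟩ ⟨w, hw, hz⟩
    refine ⟨v + w, ⟨hv.1.add hw.1, fun x => ?_⟩, fun η u hu => ?_⟩
    · have h := intervalIntegral.integral_add (hv.intervalIntegrable one_le_two x)
        (hw.intervalIntegrable one_le_two x)
      simp only [Pi.add_apply]
      rw [h, hv.2 x, hw.2 x]
      ring
    · simp only [Pi.add_apply, add_mul]
      rw [intervalIntegral.integral_add (hv.intervalIntegrable_mul hu)
        (hw.intervalIntegrable_mul hu),
        integral_add (hv.integrable_mul μ hu) (hw.integrable_mul μ hu), hy η u hu, hz η u hu]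
      ring
  smul_mem' := by
    rintro c y ⟨v, hv, hy⟩
    refine ⟨c • v, ⟨hv.1.const_smul c, fun x => ?_⟩, fun η u hu => ?_⟩
    · simp only [Pi.smul_apply, smul_eq_mul, intervalIntegral.integral_const_mul]
      rw [hv.2 x]
      ring
    · simp only [Pi.smul_apply, smul_eq_mul, mul_assoc, intervalIntegral.integral_const_mul,
        integral_const_mul]
      rw [hy η u hu]
      ring

/-- `N(lam, μ)`: the number of eigenvalues less than `lam`, counted with multiplicity (an
eigenvalue `s` of multiplicity `d` contributes the pairs `(s, k)` with `k < d`). -/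
def countingFunction (lam : ℝ) (μ : Measure I) [IsFiniteMeasure μ] : ℕ∞ :=
  {q : ℝ × ℕ | q.1 < lam ∧ (q.2 : Cardinal) < Module.rank ℝ (eigenspace μ q.1)}.encard

end

open MeasureTheory Set
open scoped ENNReal NNReal unitInterval

noncomputable section

/-! By the variational principle, the number of eigenvalues below `lam` is both the largest
dimension of a space on which energy < `lam` · mass and the least codimension of a space on which
energy ≥ `lam` · mass. A space of the first kind meets one of the second only in 0, which gives one
inequality (`HasPosSpace.le`). Sums of eigenfunctions supply the first kind
(`hasPosSpace_of_le_countingFunction`), and the spectral theorem for a compact operator supplies the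
second (`hasNonposCodim_of_countingFunction_eq`).

Composition with a bi-Lipschitz `g` transports the mass form of one measure to that of the other and
multiplies the energy by at most the Lipschitz constant `K` (`HasSobolevDeriv.comp_homeomorph`).
Hence N(λ, μ) ≤ N(Kλ, μ₀) and N(λ, μ₀) ≤ N(Kλ, μ).

It remains to absorb the factor `K`, that is, to show N(Lλ, μ₀) ≤ C · N(λ, μ₀). Put a_i = |r_i|ρ_i <
1. Restriction to cells makes the Neumann count at λ at most the sum of those at a_i λ, and gluing
functions that vanish at the end points makes the Dirichlet count at least the corresponding sum. A
bound Neumann(Lλ) ≤ C · Dirichlet(λ), valid on one bounded range of λ, therefore propagates to all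
larger λ (`AffineIFS.exists_neumann_le_mul_dirichlet`). -/

/-- There is a `d`-dimensional space of Sobolev functions on which the energy form is smaller than
`lam` times the mass form. -/
def HasPosSpace (ν : Measure I) (lam : ℝ) (d : ℕ) : Prop :=
  ∃ ψ : (Fin d → ℝ) →ₗ[ℝ] (I → ℝ), ∀ c, c ≠ 0 → ∃ v, HasSobolevDeriv 2 (ψ c) v ∧
    ∫ t in (0 : ℝ)..1, v t ^ 2 < lam * ∫ x, ψ c x ^ 2 ∂ν

/-- As `HasPosSpace`, for functions vanishing at both end points. -/
def HasDirichletPosSpace (ν : Measure I) (lam : ℝ) (d : ℕ) : Prop :=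
  ∃ ψ : (Fin d → ℝ) →ₗ[ℝ] (I → ℝ), (∀ c, ψ c 0 = 0 ∧ ψ c 1 = 0) ∧
    ∀ c, c ≠ 0 → ∃ v, HasSobolevDeriv 2 (ψ c) v ∧
      ∫ t in (0 : ℝ)..1, v t ^ 2 < lam * ∫ x, ψ c x ^ 2 ∂ν

/-- On a space of Sobolev functions of codimension at most `n` the energy form is at least `lam`
times the mass form. -/
def HasNonposCodim (ν : Measure I) (lam : ℝ) (n : ℕ) : Prop :=
  ∃ φ : (I → ℝ) →ₗ[ℝ] (Fin n → ℝ), ∀ y v, HasSobolevDeriv 2 y v → φ y = 0 →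
    lam * ∫ x, y x ^ 2 ∂ν ≤ ∫ t in (0 : ℝ)..1, v t ^ 2

/-! ### Dimension against codimension. -/

theorem HasDirichletPosSpace.hasPosSpace {ν : Measure I} {lam : ℝ} {d : ℕ}
    (h : HasDirichletPosSpace ν lam d) : HasPosSpace ν lam d :=
  h.imp fun _ h => h.2

theorem LinearMap.exists_ne_zero_map_eq_zero {d n : ℕ} (h : n < d)
    (f : (Fin d → ℝ) →ₗ[ℝ] (Fin n → ℝ)) : ∃ c, c ≠ 0 ∧ f c = 0 := by
  have := LinearMap.ker_ne_bot_of_finrank_lt (f := f) (by simpa using h)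
  obtain ⟨c, hc, h0⟩ := Submodule.exists_mem_ne_zero_of_ne_bot this
  exact ⟨c, h0, hc⟩

/-- If `n < d`, the `n` linear conditions have a nonzero common solution in the `d`-dimensional
space, where the two inequalities contradict each other. -/
theorem HasPosSpace.le {ν : Measure I} {lam : ℝ} {d n : ℕ} (h : HasPosSpace ν lam d)
    (k : HasNonposCodim ν lam n) : d ≤ n := by
  obtain ⟨ψ, hψ⟩ := h
  obtain ⟨φ, hφ⟩ := k
  by_contra! hlt
  obtain ⟨c, hc, h0⟩ := LinearMap.exists_ne_zero_map_eq_zero hlt (φ ∘ₗ ψ)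
  obtain ⟨v, hv, hlt⟩ := hψ c hc
  exact absurd (hφ _ _ hv h0) (not_le.2 hlt)

theorem HasNonposCodim.anti {ν : Measure I} {lam lam' : ℝ} {n : ℕ} (hl : lam' ≤ lam)
    (h : HasNonposCodim ν lam n) : HasNonposCodim ν lam' n := by
  obtain ⟨φ, hφ⟩ := h
  refine ⟨φ, fun y v hv h0 => le_trans ?_ (hφ y v hv h0)⟩
  gcongr

theorem hasNonposCodim_zero {ν : Measure I} {lam : ℝ} (h : lam ≤ 0) :
    HasNonposCodim ν lam 0 := by
  refine ⟨0, fun y v hv _ => (mul_nonpos_of_nonpos_of_nonneg h ?_).trans ?_⟩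
  · exact integral_nonneg fun x => sq_nonneg _
  · exact intervalIntegral.integral_nonneg zero_le_one fun x _ => sq_nonneg _

theorem hasPosSpace_of_finrank {ν : Measure I} {lam : ℝ} {d : ℕ} {X : Type*} [AddCommGroup X]
    [Module ℝ X] [FiniteDimensional ℝ X] (hX : Module.finrank ℝ X = d) (ψ : X →ₗ[ℝ] (I → ℝ))
    (h : ∀ c, c ≠ 0 → ∃ v, HasSobolevDeriv 2 (ψ c) v ∧
      ∫ t in (0 : ℝ)..1, v t ^ 2 < lam * ∫ x, ψ c x ^ 2 ∂ν) : HasPosSpace ν lam d := by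
  let e : (Fin d → ℝ) ≃ₗ[ℝ] X := LinearEquiv.ofFinrankEq _ _ (by simp [hX])
  exact ⟨ψ ∘ₗ e.toLinearMap, fun c hc => h (e c) (by simpa using hc)⟩

theorem hasDirichletPosSpace_of_finrank {ν : Measure I} {lam : ℝ} {d : ℕ} {X : Type*}
    [AddCommGroup X] [Module ℝ X] [FiniteDimensional ℝ X] (hX : Module.finrank ℝ X = d)
    (ψ : X →ₗ[ℝ] (I → ℝ)) (h0 : ∀ c, ψ c 0 = 0 ∧ ψ c 1 = 0)
    (h : ∀ c, c ≠ 0 → ∃ v, HasSobolevDeriv 2 (ψ c) v ∧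
      ∫ t in (0 : ℝ)..1, v t ^ 2 < lam * ∫ x, ψ c x ^ 2 ∂ν) : HasDirichletPosSpace ν lam d := by
  let e : (Fin d → ℝ) ≃ₗ[ℝ] X := LinearEquiv.ofFinrankEq _ _ (by simp [hX])
  exact ⟨ψ ∘ₗ e.toLinearMap, fun c => h0 (e c), fun c hc => h (e c) (by simpa using hc)⟩

theorem hasNonposCodim_of_finrank {ν : Measure I} {lam : ℝ} {n : ℕ} {X : Type*} [AddCommGroup X]
    [Module ℝ X] [FiniteDimensional ℝ X] (hX : Module.finrank ℝ X = n) (φ : (I → ℝ) →ₗ[ℝ] X)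
    (h : ∀ y v, HasSobolevDeriv 2 y v → φ y = 0 →
      lam * ∫ x, y x ^ 2 ∂ν ≤ ∫ t in (0 : ℝ)..1, v t ^ 2) : HasNonposCodim ν lam n := by
  let e : X ≃ₗ[ℝ] (Fin n → ℝ) := LinearEquiv.ofFinrankEq _ _ (by simp [hX])
  exact ⟨e.toLinearMap ∘ₗ φ, fun y v hv h0 => h y v hv (by simpa using h0)⟩

/-! ### Affine pullback and oscillation of Sobolev functions. -/

theorem integral_sq_eq_integral_indicator (v : ℝ → ℝ) :
    ∫ t in (0 : ℝ)..1, v t ^ 2 = ∫ t, (Icc (0 : ℝ) 1).indicator v t ^ 2 := by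
  rw [intervalIntegral.integral_of_le zero_le_one, ← integral_Icc_eq_integral_Ioc,
    ← integral_indicator measurableSet_Icc]
  congr 1 with t
  by_cases h : t ∈ Icc (0 : ℝ) 1 <;> simp [h]

theorem HasSobolevDeriv.memLp_indicator {p : ℝ≥0∞} {y : I → ℝ} {v : ℝ → ℝ}
    (h : HasSobolevDeriv p y v) : MemLp ((Icc (0 : ℝ) 1).indicator v) p volume :=
  (memLp_indicator_iff_restrict measurableSet_Icc).2 h.1

theorem HasSobolevDeriv.integrable_indicator {y : I → ℝ} {v : ℝ → ℝ}
    (h : HasSobolevDeriv 2 y v) : Integrable ((Icc (0 : ℝ) 1).indicator v) volume :=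
  (integrable_indicator_iff measurableSet_Icc).2 (h.1.integrable one_le_two)

theorem HasSobolevDeriv.integrable_indicator_sq {y : I → ℝ} {v : ℝ → ℝ}
    (h : HasSobolevDeriv 2 y v) :
    Integrable (fun t => (Icc (0 : ℝ) 1).indicator v t ^ 2) volume :=
  (memLp_two_iff_integrable_sq h.memLp_indicator.1).1 h.memLp_indicator

theorem HasSobolevDeriv.intervalIntegrable_sq {y : I → ℝ} {v : ℝ → ℝ}
    (h : HasSobolevDeriv 2 y v) : IntervalIntegrable (fun t => v t ^ 2) volume 0 1 := by
  simpa [pow_two] using h.intervalIntegrable_mul h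

theorem HasSobolevDeriv.integrable_sq {y : I → ℝ} {v : ℝ → ℝ} (ν : Measure I) [IsFiniteMeasure ν]
    (h : HasSobolevDeriv 2 y v) : Integrable (fun x => y x ^ 2) ν := by
  simpa [pow_two] using h.integrable_mul ν h

/-- Extending the derivative by zero amounts to extending the function by constants. -/
theorem integral_indicator_eq_projIcc (v : ℝ → ℝ) (u : ℝ) :
    ∫ t in (0 : ℝ)..u, (Icc (0 : ℝ) 1).indicator v t =
      ∫ t in (0 : ℝ)..(projIcc 0 1 zero_le_one u : I), v t := by
  rcases le_total u 0 with h | h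
  · rw [projIcc_of_le_left _ h]
    simp only [intervalIntegral.integral_same]
    rw [intervalIntegral.integral_symm, intervalIntegral.integral_of_le h,
      integral_Ioc_eq_integral_Ioo, setIntegral_eq_zero_of_forall_eq_zero, neg_zero]
    intro t ht
    simp [ht.2]
  · rcases le_total u 1 with h1 | h1
    · rw [projIcc_of_mem _ ⟨h, h1⟩]
      refine intervalIntegral.integral_congr fun t ht => ?_
      rw [uIcc_of_le h] at ht
      exact indicator_of_mem (show t ∈ Icc (0 : ℝ) 1 from ⟨ht.1, ht.2.trans h1⟩) v
    · rw [projIcc_of_right_le _ h1, intervalIntegral.integral_of_le h,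
        intervalIntegral.integral_of_le zero_le_one, ← integral_Icc_eq_integral_Ioc,
        ← integral_Icc_eq_integral_Ioc, setIntegral_indicator measurableSet_Icc,
        inter_eq_self_of_subset_right (Icc_subset_Icc_right h1)]

/-- Pullback of a Sobolev function, extended by constants, under an affine map. -/
theorem HasSobolevDeriv.comp_affine {y : I → ℝ} {v : ℝ → ℝ} (h : HasSobolevDeriv 2 y v) {r : ℝ}
    (hr : r ≠ 0) (b : ℝ) :
    HasSobolevDeriv 2 (fun x : I => y (projIcc 0 1 zero_le_one (r * x + b)))
      (fun t => r * (Icc (0 : ℝ) 1).indicator v (r * t + b)) := by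
  have hm : Measure.map (fun t : ℝ => r * t + b) volume = ENNReal.ofReal |r⁻¹| • volume := by
    have : (fun t : ℝ => r * t + b) = (fun t => t + b) ∘ (fun t => r * t) := rfl
    rw [this, ← Measure.map_map (by fun_prop) (by fun_prop), Real.map_volume_mul_left hr,
      Measure.map_smul, map_add_right_eq_self]
  constructor
  · refine MemLp.restrict _ (MemLp.const_mul ?_ r)
    have := (h.memLp_indicator.smul_measure (c := ENNReal.ofReal |r⁻¹|) ENNReal.ofReal_ne_top)
    rw [← hm] at this
    exact (memLp_map_measure_iff this.1 (by fun_prop)).1 this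
  · intro x
    have key : ∀ u, y (projIcc 0 1 zero_le_one u) =
        y 0 + ∫ t in (0 : ℝ)..u, (Icc (0 : ℝ) 1).indicator v t := fun u => by
      rw [integral_indicator_eq_projIcc, ← h.2]
    simp only [key, Icc.coe_zero]
    rw [intervalIntegral.integral_const_mul, intervalIntegral.mul_integral_comp_mul_add,
      add_assoc, intervalIntegral.integral_add_adjacent_intervals] <;>
    exact h.integrable_indicator.intervalIntegrable

theorem integral_sq_comp_affine (u : ℝ → ℝ) {r : ℝ} (hr : r ≠ 0) (b : ℝ) :
    ∫ t in (0 : ℝ)..1, (r * u (r * t + b)) ^ 2 =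
      |r| * ∫ t in (fun x : ℝ => r * x + b) '' Ioo 0 1, u t ^ 2 := by
  rw [integral_image_eq_integral_abs_deriv_smul (f' := fun _ => r) measurableSet_Ioo,
    intervalIntegral.integral_of_le zero_le_one, integral_Ioc_eq_integral_Ioo,
    ← integral_const_mul]
  · congr 1 with t
    simp only [smul_eq_mul]
    rw [← mul_assoc, abs_mul_abs_self]
    ring
  · intro x _
    simpa using (((hasDerivAt_id x).const_mul r).add_const b).hasDerivWithinAt
  · intro x _ y _ hxy
    simpa [hr] using hxy

theorem HasSobolevDeriv.energy_comp_affine_le {y : I → ℝ} {v : ℝ → ℝ} (h : HasSobolevDeriv 2 y v)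
    {r : ℝ} (hr : r ≠ 0) (b : ℝ) :
    ∫ t in (0 : ℝ)..1, (r * (Icc (0 : ℝ) 1).indicator v (r * t + b)) ^ 2 ≤
      |r| * ∫ t in (0 : ℝ)..1, v t ^ 2 := by
  rw [integral_sq_comp_affine _ hr, integral_sq_eq_integral_indicator]
  gcongr
  · exact Filter.Eventually.of_forall fun t => sq_nonneg _
  · exact h.integrable_indicator_sq
  · exact Measure.restrict_le_self

/-- The Cauchy–Schwarz bound for the oscillation of a Sobolev function. -/
theorem HasSobolevDeriv.sq_sub_le {y : I → ℝ} {v : ℝ → ℝ} (h : HasSobolevDeriv 2 y v) (a b : I) :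
    (y a - y b) ^ 2 ≤ |(a : ℝ) - b| * ∫ t in (0 : ℝ)..1, v t ^ 2 := by
  wlog hab : (b : ℝ) ≤ a generalizing a b
  · have := this b a (le_of_not_ge hab)
    rwa [abs_sub_comm, ← neg_sub, neg_sq] at this
  have e : y a - y b = ∫ t in (b : ℝ)..a, v t := by
    rw [h.2 a, h.2 b, ← intervalIntegral.integral_interval_sub_left
      (h.intervalIntegrable one_le_two a) (h.intervalIntegrable one_le_two b)]
    ring
  have hsub : Ioc (b : ℝ) a ⊆ Ioc 0 1 := Ioc_subset_Ioc b.2.1 a.2.2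
  have hi2 : IntegrableOn (fun t => v t ^ 2) (Ioc (b : ℝ) a) := by
    have := h.intervalIntegrable_sq
    rw [intervalIntegrable_iff_integrableOn_Ioc_of_le zero_le_one] at this
    exact this.mono_set hsub
  have hi1 : IntegrableOn v (Ioc (b : ℝ) a) := by
    have := h.intervalIntegrable one_le_two 1
    rw [intervalIntegrable_iff_integrableOn_Ioc_of_le (by simp)] at this
    exact this.mono_set (by simpa using hsub)
  have mono : ∫ t in Ioc (b : ℝ) a, v t ^ 2 ≤ ∫ t in (0 : ℝ)..1, v t ^ 2 := by
    rw [intervalIntegral.integral_of_le zero_le_one]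
    refine setIntegral_mono_set ?_ (Filter.Eventually.of_forall fun t => sq_nonneg _)
      hsub.eventuallyLE
    exact (intervalIntegrable_iff_integrableOn_Ioc_of_le zero_le_one).1 h.intervalIntegrable_sq
  rw [e, intervalIntegral.integral_of_le hab, abs_of_nonneg (by linarith)]
  set A := ∫ t in Ioc (b : ℝ) a, v t
  set B := ∫ t in Ioc (b : ℝ) a, v t ^ 2
  -- Cauchy–Schwarz by the discriminant: this quadratic in `s` is ∫(v + s)², and its minimum is at
  -- `s = -A / (a - b)`.
  have hq : ∀ s : ℝ, 0 ≤ B + s * (2 * A) + s ^ 2 * (a - b) := by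
    intro s
    have : ∫ t in Ioc (b : ℝ) a, (v t + s) ^ 2 = B + s * (2 * A) + s ^ 2 * (a - b) := by
      have e1 : ∀ t, (v t + s) ^ 2 = v t ^ 2 + (s * 2) * v t + s ^ 2 := fun t => by ring
      simp only [e1]
      have hi3 : IntegrableOn (fun t => s * 2 * v t) (Ioc (b : ℝ) a) := hi1.const_mul _
      rw [integral_add (f := fun t => v t ^ 2 + s * 2 * v t) (Integrable.add hi2 hi3)
        (integrable_const _),
        integral_add hi2 hi3, integral_const_mul]
      simp [A, B, hab]
      ring
    rw [← this]
    exact integral_nonneg fun t => sq_nonneg _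
  have hB : A ^ 2 ≤ ((a : ℝ) - b) * B := by
    rcases hab.eq_or_lt with he | hlt
    · simp [A, he]
    · have := hq (-A / (a - b))
      have hp : (0 : ℝ) < a - b := by linarith
      have e2 : B + -A / (a - b) * (2 * A) + (-A / (a - b)) ^ 2 * (a - b) =
        B - A ^ 2 / (a - b) := by field_simp; ring
      rw [e2, sub_nonneg, div_le_iff₀ hp] at this
      linarith
  exact hB.trans (by gcongr)

/-- Impose vanishing at the `n` nodes i/n with `n > max lam 0`. Every point is within 1/n of a node,
so y² ≤ energy/n everywhere, and ν has mass one. -/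
theorem exists_hasNonposCodim (ν : Measure I) [IsProbabilityMeasure ν] (lam : ℝ) :
    ∃ n, HasNonposCodim ν lam n := by
  obtain ⟨n, hn⟩ := exists_nat_gt (max lam 0)
  have hn0 : (0 : ℝ) < n := (le_max_right _ _).trans_lt hn
  have hp : 0 < n := by exact_mod_cast hn0
  let q : Fin n → I := fun i => ⟨(i : ℝ) / n, by positivity, by
    rw [div_le_one hn0]; exact_mod_cast i.2.le⟩
  refine ⟨n, LinearMap.funLeft ℝ ℝ q, fun y v hv h0 => ?_⟩
  have hE : 0 ≤ ∫ t in (0 : ℝ)..1, v t ^ 2 :=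
    intervalIntegral.integral_nonneg zero_le_one fun x _ => sq_nonneg _
  have hb : ∀ x, y x ^ 2 ≤ (1 / n) * ∫ t in (0 : ℝ)..1, v t ^ 2 := by
    intro x
    have : ∃ i : Fin n, |(x : ℝ) - q i| ≤ 1 / n := by
      -- The nodes stop at (n-1)/n, so for x = 1 the floor index is out of range and the last node
      -- is used.
      rcases x.2.2.eq_or_lt with h1 | h1
      · refine ⟨⟨n - 1, by omega⟩, ?_⟩
        simp only [q, h1]
        rw [Nat.cast_sub hp]
        have : (1 : ℝ) - (n - (1 : ℕ)) / n = 1 / n := by field_simp; simp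
        rw [this, abs_of_nonneg (by positivity)]
      · have hx := mul_nonneg x.2.1 hn0.le
        have h2 := Nat.floor_le hx
        have h3 := Nat.lt_floor_add_one ((x : ℝ) * n)
        refine ⟨⟨⌊(x : ℝ) * n⌋₊, ?_⟩, ?_⟩
        · rw [Nat.floor_lt hx]
          nlinarith
        · simp only [q]
          have : (x : ℝ) - ⌊(x : ℝ) * n⌋₊ / n = ((x : ℝ) * n - ⌊(x : ℝ) * n⌋₊) / n := by
            field_simp
          rw [this, abs_of_nonneg (div_nonneg (by linarith) hn0.le)]
          gcongr
          linarith
    obtain ⟨i, hi⟩ := this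
    have hz : y (q i) = 0 := congrFun h0 i
    have := hv.sq_sub_le x (q i)
    rw [hz, sub_zero] at this
    exact this.trans (by gcongr)
  have h1 : ∫ x, y x ^ 2 ∂ν ≤ (1 / n) * ∫ t in (0 : ℝ)..1, v t ^ 2 := by
    calc _ ≤ ∫ _x, (1 / n) * (∫ t in (0 : ℝ)..1, v t ^ 2) ∂ν :=
          integral_mono (hv.integrable_sq ν) (integrable_const _) hb
      _ = _ := by simp
  have h2 : 0 ≤ ∫ x, y x ^ 2 ∂ν := integral_nonneg fun x => sq_nonneg _
  calc lam * ∫ x, y x ^ 2 ∂ν ≤ n * ∫ x, y x ^ 2 ∂ν := by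
        gcongr; exact (le_max_left _ _).trans hn.le
    _ ≤ n * ((1 / n) * ∫ t in (0 : ℝ)..1, v t ^ 2) := by gcongr
    _ = _ := by field_simp

/-- Constants have zero energy and positive mass. -/
theorem hasPosSpace_one {ν : Measure I} [IsProbabilityMeasure ν] {lam : ℝ} (h : 0 < lam) :
    HasPosSpace ν lam 1 := by
  refine hasPosSpace_of_finrank (X := ℝ) (by simp) (LinearMap.pi fun _ => LinearMap.id)
    fun c hc => ⟨0, ⟨MemLp.zero, by simp⟩, ?_⟩
  simp
  positivity

/-! ### Cells and self-similarity. -/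

namespace AffineIFS

variable {m : ℕ} (F : AffineIFS m)

/-- The open cell of index `i`. -/
def cell (i : Fin m) : Set ℝ := (fun x : ℝ => F.ratio i * x + F.shift i) '' Ioo 0 1

theorem mem_cell_iff (i : Fin m) (t : ℝ) :
    t ∈ F.cell i ↔ (F.ratio i)⁻¹ * t + -((F.ratio i)⁻¹ * F.shift i) ∈ Ioo (0 : ℝ) 1 := by
  have hr := F.ratio_ne_zero i
  constructor
  · rintro ⟨x, hx, rfl⟩
    convert hx using 1
    field_simp
    ring
  · intro h
    refine ⟨_, h, ?_⟩
    field_simp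
    ring

theorem isOpen_cell (i : Fin m) : IsOpen (F.cell i) := by
  have : F.cell i = (fun t => (F.ratio i)⁻¹ * t + -((F.ratio i)⁻¹ * F.shift i)) ⁻¹' Ioo 0 1 :=
    Set.ext fun t => F.mem_cell_iff i t
  rw [this]
  exact isOpen_Ioo.preimage (by fun_prop)

theorem disjoint_cell {i j : Fin m} (h : i ≠ j) : Disjoint (F.cell i) (F.cell j) :=
  F.disjoint_interiors i j h

theorem S_mem_closure_cell (i : Fin m) (x : I) : (F.S i x : ℝ) ∈ closure (F.cell i) := by
  have : Continuous fun x : ℝ => F.ratio i * x + F.shift i := by fun_prop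
  refine image_closure_subset_closure_image this ⟨x, ?_, rfl⟩
  rw [closure_Ioo zero_ne_one]
  exact x.2

/-- An open set disjoint from another cell is also disjoint from its closure, so end points shared
by neighbouring cells do no harm. -/
theorem S_notMem_cell {i j : Fin m} (h : i ≠ j) (x : I) : (F.S j x : ℝ) ∉ F.cell i := fun hx =>
  ((F.disjoint_cell h).closure_right (F.isOpen_cell i)).notMem_of_mem_left hx
    (F.S_mem_closure_cell j x)

theorem continuous_S (i : Fin m) : Continuous (F.S i) := by
  unfold S
  fun_prop

/-- Transplantation of a function on `[0,1]` to the cell of index `i`. -/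
def transplant (i : Fin m) (x : I) : I :=
  projIcc 0 1 zero_le_one ((F.ratio i)⁻¹ * x + -((F.ratio i)⁻¹ * F.shift i))

theorem transplant_S (i : Fin m) (x : I) : F.transplant i (F.S i x) = x := by
  have hr := F.ratio_ne_zero i
  have : (F.ratio i)⁻¹ * (F.S i x : ℝ) + -((F.ratio i)⁻¹ * F.shift i) = x := by
    simp only [S]
    field_simp
    ring
  rw [transplant, this, projIcc_val]

/-- This is why functions vanishing at both end points transplant to a cell with extension by zero.
-/
theorem transplant_eq_of_notMem (i : Fin m) {x : I} (h : (x : ℝ) ∉ F.cell i) :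
    F.transplant i x = 0 ∨ F.transplant i x = 1 := by
  rw [mem_cell_iff, mem_Ioo, not_and_or, not_lt, not_lt] at h
  rcases h with h | h
  · exact .inl (projIcc_of_le_left _ h)
  · exact .inr (projIcc_of_right_le _ h)

theorem zero_notMem_cell (i : Fin m) : (0 : ℝ) ∉ F.cell i := by
  rintro ⟨x, hx, h⟩
  have h0 := (F.mapsTo i 0 (by simp)).1
  have h1 := (F.mapsTo i 1 (by simp)).1
  have hr := F.ratio_ne_zero i
  simp only at h
  rcases hr.lt_or_gt with hr | hr <;> nlinarith [hx.1, hx.2]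

theorem one_notMem_cell (i : Fin m) : (1 : ℝ) ∉ F.cell i := by
  rintro ⟨x, hx, h⟩
  have h0 := (F.mapsTo i 0 (by simp)).2
  have h1 := (F.mapsTo i 1 (by simp)).2
  have hr := F.ratio_ne_zero i
  simp only at h
  rcases hr.lt_or_gt with hr | hr <;> nlinarith [hx.1, hx.2]

/-- Only an inequality, since the cells are disjoint but need not cover the interval. -/
theorem sum_setIntegral_cell_le {f : ℝ → ℝ} (hf : Integrable f) (h0 : ∀ t, 0 ≤ f t) :
    ∑ i, ∫ t in F.cell i, f t ≤ ∫ t, f t := by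
  rw [← integral_biUnion_finset Finset.univ (fun i _ => (F.isOpen_cell i).measurableSet)
    (fun i _ j _ h => F.disjoint_cell h) (fun i _ => hf.integrableOn)]
  exact setIntegral_le_integral hf (Filter.Eventually.of_forall h0)

theorem sum_weight_mul_integral {μ₀ : Measure I} [IsProbabilityMeasure μ₀]
    (h : IsSelfSimilarMeasure F μ₀) {f : I → ℝ} (hf : Continuous f) :
    ∫ x, f x ∂μ₀ = ∑ i, F.weight i * ∫ x, f (F.S i x) ∂μ₀ := by
  have e : μ₀ = ∑ i, ENNReal.ofReal (F.weight i) • μ₀.map (F.S i) := by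
    ext E hE
    rw [h E hE, Measure.finsetSum_apply]
    refine Finset.sum_congr rfl fun i _ => ?_
    rw [Measure.smul_apply, Measure.map_apply (F.continuous_S i).measurable hE, smul_eq_mul]
  have hi : ∀ ν : Measure I, IsFiniteMeasure ν → Integrable f ν := fun ν _ =>
    hf.integrable_of_hasCompactSupport (HasCompactSupport.of_compactSpace _)
  conv_lhs => rw [e]
  rw [integral_finsetSum_measure]
  · refine Finset.sum_congr rfl fun i _ => ?_
    rw [integral_smul_measure, integral_map (F.continuous_S i).aemeasurable
      hf.aestronglyMeasurable, ENNReal.toReal_ofReal (F.weight_pos i).le, smul_eq_mul]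
  · intro i _
    have := Measure.isFiniteMeasure_map μ₀ (F.S i)
    exact (hi _ this).smul_measure ENNReal.ofReal_ne_top

/-- Subadditivity of the Neumann counting function. -/
theorem hasNonposCodim_sum {μ₀ : Measure I} [IsProbabilityMeasure μ₀]
    (hμ : IsSelfSimilarMeasure F μ₀) {lam : ℝ} {n : Fin m → ℕ}
    (h : ∀ i, HasNonposCodim μ₀ (|F.ratio i| * F.weight i * lam) (n i)) :
    HasNonposCodim μ₀ lam (∑ i, n i) := by
  choose φ hφ using h
  refine hasNonposCodim_of_finrank (X := ∀ i, Fin (n i) → ℝ)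
    (by rw [Module.finrank_pi_fintype]; simp)
    (LinearMap.pi fun i => φ i ∘ₗ LinearMap.funLeft ℝ ℝ (F.S i)) fun y v hv h0 => ?_
  have hS : ∀ i, (fun x => y (F.S i x)) =
      fun x : I => y (projIcc 0 1 zero_le_one (F.ratio i * x + F.shift i)) := by
    intro i
    ext x
    rw [projIcc_of_mem _ (F.mapsTo i x x.2)]
    rfl
  have hy := hv.continuous one_le_two
  rw [F.sum_weight_mul_integral hμ (f := fun x => y x ^ 2) (hy.pow 2), Finset.mul_sum,
    integral_sq_eq_integral_indicator]
  refine le_trans (Finset.sum_le_sum fun i _ => ?_)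
    (F.sum_setIntegral_cell_le hv.integrable_indicator_sq fun t => sq_nonneg _)
  have hr := F.ratio_ne_zero i
  have h1 := hv.comp_affine hr (F.shift i)
  rw [← hS] at h1
  have h2 := hφ i _ _ h1 (congrFun h0 i)
  -- The pullback has `|F.ratio i|` times the energy of `y` on the cell; this factor cancels against
  -- the one in the scaled spectral parameter.
  rw [integral_sq_comp_affine _ hr] at h2
  have hp : 0 < |F.ratio i| := abs_pos.2 hr
  refine le_of_mul_le_mul_left ?_ hp
  rw [cell]
  linarith

/-- Superadditivity of the Dirichlet counting function. -/
theorem hasDirichletPosSpace_sum {μ₀ : Measure I} [IsProbabilityMeasure μ₀]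
    (hμ : IsSelfSimilarMeasure F μ₀) {lam : ℝ} {d : Fin m → ℕ}
    (h : ∀ i, HasDirichletPosSpace μ₀ (|F.ratio i| * F.weight i * lam) (d i)) :
    HasDirichletPosSpace μ₀ lam (∑ i, d i) := by
  choose ψ hψ0 hψ using h
  have hψ' : ∀ i c, ∃ v, HasSobolevDeriv 2 (ψ i c) v ∧ ∫ t in (0 : ℝ)..1, v t ^ 2 ≤
      |F.ratio i| * F.weight i * lam * ∫ x, ψ i c x ^ 2 ∂μ₀ := by
    intro i c
    by_cases hc : c = 0
    · exact ⟨0, ⟨MemLp.zero, by simp [hc]⟩, by simp [hc]⟩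
    · exact (hψ i c hc).imp fun v hv => ⟨hv.1, hv.2.le⟩
  let Ψ : (∀ i, Fin (d i) → ℝ) →ₗ[ℝ] (I → ℝ) :=
    ∑ i, LinearMap.funLeft ℝ ℝ (F.transplant i) ∘ₗ ψ i ∘ₗ LinearMap.proj i
  have hΨ : ∀ c x, Ψ c x = ∑ i, ψ i (c i) (F.transplant i x) := by
    intro c x
    simp [Ψ, LinearMap.funLeft_apply]
  have hout : ∀ i (c : Fin (d i) → ℝ) (x : I), (x : ℝ) ∉ F.cell i → ψ i c (F.transplant i x) = 0 := by
    intro i c x hx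
    rcases F.transplant_eq_of_notMem i hx with h | h
    · rw [h]; exact (hψ0 i c).1
    · rw [h]; exact (hψ0 i c).2
  have hΨS : ∀ c j x, Ψ c (F.S j x) = ψ j (c j) x := by
    intro c j x
    rw [hΨ, Finset.sum_eq_single j, F.transplant_S]
    · exact fun i _ hij => hout _ _ _ (F.S_notMem_cell hij x)
    · simp
  refine hasDirichletPosSpace_of_finrank (X := ∀ i, Fin (d i) → ℝ)
    (by rw [Module.finrank_pi_fintype]; simp) Ψ
    (fun c => ⟨?_, ?_⟩) fun c hc => ?_
  · rw [hΨ]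
    exact Finset.sum_eq_zero fun i _ => hout _ _ _ (by simpa using F.zero_notMem_cell i)
  · rw [hΨ]
    exact Finset.sum_eq_zero fun i _ => hout _ _ _ (by simpa using F.one_notMem_cell i)
  have hv : ∀ i, ∃ v, HasSobolevDeriv 2 (ψ i (c i)) v ∧ (∫ t in (0 : ℝ)..1, v t ^ 2 ≤
      |F.ratio i| * F.weight i * lam * ∫ x, ψ i (c i) x ^ 2 ∂μ₀) ∧ (c i ≠ 0 →
      ∫ t in (0 : ℝ)..1, v t ^ 2 < |F.ratio i| * F.weight i * lam *
        ∫ x, ψ i (c i) x ^ 2 ∂μ₀) := by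
    intro i
    by_cases hc : c i = 0
    · exact (hψ' i (c i)).imp fun v hv => ⟨hv.1, hv.2, fun h => absurd hc h⟩
    · exact (hψ i (c i) hc).imp fun v hv => ⟨hv.1, hv.2.le, fun _ => hv.2⟩
  choose v hv hle hlt using hv
  have hr := fun i => inv_ne_zero (F.ratio_ne_zero i)
  let w : Fin m → ℝ → ℝ := fun i t => (F.ratio i)⁻¹ * (Icc (0 : ℝ) 1).indicator (v i)
    ((F.ratio i)⁻¹ * t + -((F.ratio i)⁻¹ * F.shift i))
  have hw : ∀ i, HasSobolevDeriv 2 (fun x => ψ i (c i) (F.transplant i x)) (w i) := fun i =>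
    (hv i).comp_affine (hr i) _
  have hwE : ∀ i, ∫ t in (0 : ℝ)..1, w i t ^ 2 ≤ |F.ratio i|⁻¹ * ∫ t in (0 : ℝ)..1, v i t ^ 2 := by
    intro i
    rw [← abs_inv]
    exact (hv i).energy_comp_affine_le (hr i) _
  -- The end points of the cells are a null set, so almost everywhere at most one of the
  -- transplanted derivatives is nonzero. The cross terms of the energy then vanish.
  have hae : ∀ᵐ t, ∀ i, w i t ≠ 0 → t ∈ F.cell i := by
    rw [ae_all_iff]
    intro i
    have hfin : ({F.shift i, F.ratio i + F.shift i} : Set ℝ).Finite := by simp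
    filter_upwards [hfin.measure_zero volume |> measure_eq_zero_iff_ae_notMem.1] with t ht hwt
    rw [mem_cell_iff]
    have hr := F.ratio_ne_zero i
    have hmem : (F.ratio i)⁻¹ * t + -((F.ratio i)⁻¹ * F.shift i) ∈ Icc (0 : ℝ) 1 := by
      by_contra hn
      exact hwt (by simp only [w]; rw [indicator_of_notMem hn, mul_zero])
    simp only [mem_insert_iff, mem_singleton_iff, not_or] at ht
    refine ⟨hmem.1.lt_of_ne fun h => ht.1 ?_, hmem.2.lt_of_ne fun h => ht.2 ?_⟩
    · field_simp at h
      linarith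
    · field_simp at h
      linarith
  have hW : HasSobolevDeriv 2 (Ψ c) (fun t => ∑ i, w i t) := by
    constructor
    · exact memLp_finsetSum _ fun i _ => (hw i).1
    · intro x
      rw [intervalIntegral.integral_finsetSum fun i _ => (hw i).intervalIntegrable one_le_two x,
        hΨ, hΨ, ← Finset.sum_add_distrib]
      exact Finset.sum_congr rfl fun i _ => (hw i).2 x
  refine ⟨_, hW, ?_⟩
  have hE : ∫ t in (0 : ℝ)..1, (∑ i, w i t) ^ 2 = ∑ i, ∫ t in (0 : ℝ)..1, w i t ^ 2 := by
    rw [← intervalIntegral.integral_finsetSum fun i _ => (hw i).intervalIntegrable_sq]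
    refine intervalIntegral.integral_congr_ae ?_
    filter_upwards [hae] with t ht _
    rw [pow_two, Finset.sum_mul_sum]
    refine Finset.sum_congr rfl fun i _ => ?_
    rw [Finset.sum_eq_single i, pow_two]
    · intro j _ hji
      by_contra hne
      exact (F.disjoint_cell hji).notMem_of_mem_left (ht j (right_ne_zero_of_mul hne))
        (ht i (left_ne_zero_of_mul hne))
    · simp
  rw [hE, F.sum_weight_mul_integral hμ (f := fun x => Ψ c x ^ 2)
    ((hW.continuous one_le_two).pow 2), Finset.mul_sum]
  simp only [hΨS]
  have hp := fun i => abs_pos.2 (F.ratio_ne_zero i)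
  have key : ∀ i, |F.ratio i|⁻¹ * (|F.ratio i| * F.weight i * lam * ∫ x, ψ i (c i) x ^ 2 ∂μ₀) =
      lam * (F.weight i * ∫ x, ψ i (c i) x ^ 2 ∂μ₀) := by
    intro i
    have := (hp i).ne'
    field_simp
  -- Components with `c i = 0` give only a weak inequality; strictness comes from one nonzero
  -- component.
  refine Finset.sum_lt_sum (fun i _ => (hwE i).trans ?_) ?_
  · rw [← key]
    exact mul_le_mul_of_nonneg_left (hle i) (inv_nonneg.2 (hp i).le)
  · obtain ⟨i, hi⟩ := Function.ne_iff.1 hc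
    refine ⟨i, Finset.mem_univ _, (hwE i).trans_lt ?_⟩
    rw [← key]
    exact mul_lt_mul_of_pos_left (hlt i hi) (inv_pos.2 (hp i))

end AffineIFS

theorem HasDirichletPosSpace.mono {ν : Measure I} {lam lam' : ℝ} {d : ℕ} (hl : lam ≤ lam')
    (h : HasDirichletPosSpace ν lam d) : HasDirichletPosSpace ν lam' d := by
  obtain ⟨ψ, h0, hψ⟩ := h
  refine ⟨ψ, h0, fun c hc => (hψ c hc).imp fun v hv => ⟨hv.1, hv.2.trans_le ?_⟩⟩
  gcongr

theorem hasSobolevDeriv_mul_one_sub (c : ℝ) :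
    HasSobolevDeriv 2 (fun x : I => c * ((x : ℝ) * (1 - x))) (fun t => c * (1 - 2 * t)) := by
  constructor
  · have hc : ContinuousOn (fun t : ℝ => c * (1 - 2 * t)) (Icc 0 1) := by fun_prop
    exact (memLp_two_iff_integrable_sq (hc.aestronglyMeasurable measurableSet_Icc)).2
      ((hc.pow 2).integrableOn_Icc)
  · intro x
    have : ∫ t in (0 : ℝ)..x, c * (1 - 2 * t) = c * (x * (1 - x)) - c * (0 * (1 - 0)) := by
      refine intervalIntegral.integral_eq_sub_of_hasDerivAt (f := fun t => c * (t * (1 - t)))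
        (fun t _ => ?_) (Continuous.intervalIntegrable (by fun_prop) _ _)
      refine (((hasDerivAt_id t).mul ((hasDerivAt_id t).const_sub 1)).const_mul c).congr_deriv ?_
      simp only [id_eq]
      ring
    rw [this]
    simp

/-- The parabola x(1 - x) has positive mass `b` because ν charges the interior; with energy `e`, the
value `(e + 1) / b` suffices. -/
theorem exists_hasDirichletPosSpace_one {ν : Measure I} [IsProbabilityMeasure ν]
    (h : ν {x : I | (x : ℝ) ∈ Ioo (0 : ℝ) 1} ≠ 0) :
    ∃ lam, 0 < lam ∧ HasDirichletPosSpace ν lam 1 := by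
  have hc : 0 < ∫ x : I, ((x : ℝ) * (1 - x)) ^ 2 ∂ν := by
    have hcont : Continuous fun x : I => ((x : ℝ) * (1 - x)) ^ 2 := by fun_prop
    rw [integral_pos_iff_support_of_nonneg (fun x => sq_nonneg _)
      (hcont.integrable_of_hasCompactSupport (HasCompactSupport.of_compactSpace _))]
    refine (pos_iff_ne_zero.2 h).trans_le (measure_mono fun x hx => ?_)
    have h1 : (x : ℝ) ≠ 0 := hx.1.ne'
    have h2 : (1 : ℝ) - x ≠ 0 := (sub_pos.2 hx.2).ne'
    exact pow_ne_zero _ (mul_ne_zero h1 h2)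
  set b := ∫ x : I, ((x : ℝ) * (1 - x)) ^ 2 ∂ν
  set e := ∫ t in (0 : ℝ)..1, (1 - 2 * t) ^ 2
  have he : 0 ≤ e := intervalIntegral.integral_nonneg zero_le_one fun x _ => sq_nonneg _
  refine ⟨(e + 1) / b, by positivity, hasDirichletPosSpace_of_finrank (X := ℝ) (by simp)
    (LinearMap.toSpanSingleton ℝ (I → ℝ) fun x : I => (x : ℝ) * (1 - x)) (by simp)
    fun c hc0 => ⟨_, hasSobolevDeriv_mul_one_sub c, ?_⟩⟩
  have e2 : ∀ x : I, (LinearMap.toSpanSingleton ℝ (I → ℝ) (fun x : I => (x : ℝ) * (1 - x))) c x =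
    c * ((x : ℝ) * (1 - x)) := fun x => rfl
  simp only [e2]
  simp only [mul_pow c]
  rw [intervalIntegral.integral_const_mul, integral_const_mul]
  change c ^ 2 * e < (e + 1) / b * (c ^ 2 * b)
  have : (e + 1) / b * (c ^ 2 * b) = c ^ 2 * (e + 1) := by field_simp
  rw [this]
  have : 0 < c ^ 2 := by positivity
  nlinarith

namespace AffineIFS

variable {m : ℕ} (F : AffineIFS m)

theorem weight_lt_one (hm : 2 ≤ m) (i : Fin m) : F.weight i < 1 := by
  have : Nontrivial (Fin m) := Fin.nontrivial_iff_two_le.2 hm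
  obtain ⟨j, hj⟩ := exists_ne i
  rw [← F.sum_weight]
  exact Finset.single_lt_sum hj (Finset.mem_univ _) (Finset.mem_univ _) (F.weight_pos j)
    fun k _ _ => (F.weight_pos k).le

/-- Otherwise both maps have the same orientation and both cells abut the same end point of [0,1],
so they overlap. -/
theorem S_ne_of_endpoint {i j : Fin m} (hij : i ≠ j) {x e : I} (hx : x = 0 ∨ x = 1)
    (he : e = 0 ∨ e = 1) (hi : F.S i x = e) : F.S j x ≠ e := by
  intro hj
  have ei : F.ratio i * x + F.shift i = e := congrArg Subtype.val hi
  have ej : F.ratio j * x + F.shift j = e := congrArg Subtype.val hj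
  have hri := F.ratio_ne_zero i
  have hrj := F.ratio_ne_zero j
  have hi1 := abs_pos.2 hri
  have hj1 := abs_pos.2 hrj
  have hi2 := F.abs_ratio_lt_one i
  have hj2 := F.abs_ratio_lt_one j
  have mi := F.mapsTo i (1 - x) ⟨by linarith [x.2.2], by linarith [x.2.1]⟩
  have mj := F.mapsTo j (1 - x) ⟨by linarith [x.2.2], by linarith [x.2.1]⟩
  have hs : F.ratio i * |F.ratio j| = F.ratio j * |F.ratio i| := by
    have : 0 < F.ratio i ∧ 0 < F.ratio j ∨ F.ratio i < 0 ∧ F.ratio j < 0 := by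
      rcases hri.lt_or_gt with h1 | h1 <;> rcases hrj.lt_or_gt with h2 | h2
      · exact .inr ⟨h1, h2⟩
      · exfalso
        rcases hx with rfl | rfl <;> rcases he with rfl | rfl <;> simp at * <;> linarith
      · exfalso
        rcases hx with rfl | rfl <;> rcases he with rfl | rfl <;> simp at * <;> linarith
      · exact .inl ⟨h1, h2⟩
    rcases this with ⟨h1, h2⟩ | ⟨h1, h2⟩
    · rw [abs_of_pos h1, abs_of_pos h2, mul_comm]
    · rw [abs_of_neg h1, abs_of_neg h2]; ring
  have hmem : ∀ θ : ℝ, 0 < θ → θ < 1 → (x : ℝ) + (1 / 2 - x) * θ ∈ Ioo (0 : ℝ) 1 := by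
    intro θ h0 h1
    rcases hx with rfl | rfl
    · constructor <;> simp <;> linarith
    · constructor <;> simp <;> linarith
  -- Moving inwards from `x` with parameter |r_j| in cell `i` and |r_i| in cell `j` reaches the same
  -- point.
  refine (F.disjoint_cell hij).notMem_of_mem_left ⟨_, hmem _ hj1 hj2, rfl⟩
    ⟨_, hmem _ hi1 hi2, ?_⟩
  simp only
  linear_combination ej - ei - (1 / 2 - (x : ℝ)) * hs

/-- If μ₀ lived on {0,1}, it would have an atom there, and images of atoms are atoms. Two different
maps send that atom to different end points, so both 0 and 1 are atoms. Then one contraction maps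
{0,1} into itself, forcing a ratio 0 or ±1. -/
theorem measure_interior_ne_zero (hm : 2 ≤ m) {μ₀ : Measure I} [IsProbabilityMeasure μ₀]
    (h : IsSelfSimilarMeasure F μ₀) : μ₀ {x : I | (x : ℝ) ∈ Ioo (0 : ℝ) 1} ≠ 0 := by
  intro h0
  have hS : ∀ i x, μ₀ {x} ≠ 0 → μ₀ {F.S i x} ≠ 0 := by
    intro i x hx hz
    rw [h _ (measurableSet_singleton _), Finset.sum_eq_zero_iff] at hz
    have := hz i (Finset.mem_univ _)
    rcases mul_eq_zero.1 this with hw | hw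
    · exact (ENNReal.ofReal_pos.2 (F.weight_pos i)).ne' hw
    · exact hx (measure_mono_null (by simp) hw)
  have hsub : ∀ x : I, μ₀ {x} ≠ 0 → x = 0 ∨ x = 1 := by
    intro x hx
    by_contra! hne
    refine hx (measure_mono_null (singleton_subset_iff.2 ?_) h0)
    exact ⟨x.2.1.lt_of_ne fun h => hne.1 (Subtype.ext h.symm),
      x.2.2.lt_of_ne fun h => hne.2 (Subtype.ext h)⟩
  obtain ⟨x, hx⟩ : ∃ x, μ₀ {x} ≠ 0 := by
    by_contra! hall
    have hu : (univ : Set I) ⊆ {x : I | (x : ℝ) ∈ Ioo (0 : ℝ) 1} ∪ {0} ∪ {1} := by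
      intro x _
      by_cases h1 : x = 0
      · simp [h1]
      by_cases h2 : x = 1
      · simp [h2]
      refine .inl (.inl ⟨x.2.1.lt_of_ne fun h => h1 (Subtype.ext h.symm),
        x.2.2.lt_of_ne fun h => h2 (Subtype.ext h)⟩)
    have := measure_mono_null hu (measure_union_null (measure_union_null h0 (hall 0)) (hall 1))
    simp at this
  have : Nontrivial (Fin m) := Fin.nontrivial_iff_two_le.2 hm
  obtain ⟨i, j, hij⟩ := exists_pair_ne (Fin m)
  have hne := F.S_ne_of_endpoint hij (hsub x hx) (hsub _ (hS i x hx)) rfl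
  have h01 : μ₀ {(0 : I)} ≠ 0 ∧ μ₀ {(1 : I)} ≠ 0 := by
    have h1 := hS i x hx
    have h2 := hS j x hx
    rcases hsub _ h1 with h3 | h3 <;> rcases hsub _ h2 with h4 | h4 <;> rw [h3] at h1 hne <;>
      rw [h4] at h2 hne
    · exact absurd rfl hne
    · exact ⟨h1, h2⟩
    · exact ⟨h2, h1⟩
    · exact absurd rfl hne
  have ha := F.abs_ratio_lt_one i
  have hb := F.ratio_ne_zero i
  rw [abs_lt] at ha
  rcases hsub _ (hS i _ h01.1) with h1 | h1 <;> rcases hsub _ (hS i _ h01.2) with h2 | h2 <;>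
    have h3 := congrArg Subtype.val h1 <;> have h4 := congrArg Subtype.val h2 <;>
    simp [S] at h3 h4
  · exact hb (by linarith)
  · linarith
  · linarith
  · exact hb (by linarith)

/-- Comparison of the Neumann counting function at `L * lam` with the Dirichlet one at `lam`. -/
theorem exists_neumann_le_mul_dirichlet (hm : 2 ≤ m) {μ₀ : Measure I} [IsProbabilityMeasure μ₀]
    (h : IsSelfSimilarMeasure F μ₀) {L : ℝ} (hL : 0 < L) :
    ∃ lam₀, 0 < lam₀ ∧ ∃ C : ℕ, ∀ lam, lam₀ ≤ lam → ∃ n d, HasNonposCodim μ₀ (L * lam) n ∧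
      HasDirichletPosSpace μ₀ lam d ∧ n ≤ C * d := by
  have : Nonempty (Fin m) := ⟨⟨0, by omega⟩⟩
  obtain ⟨lam₀, h0, hD⟩ := exists_hasDirichletPosSpace_one (F.measure_interior_ne_zero hm h)
  set a : Fin m → ℝ := fun i => |F.ratio i| * F.weight i with ha
  have ha0 : ∀ i, 0 < a i := fun i => mul_pos (abs_pos.2 (F.ratio_ne_zero i)) (F.weight_pos i)
  have ha1 : ∀ i, a i < 1 := fun i => by
    have := mul_lt_mul'' (F.abs_ratio_lt_one i) (F.weight_lt_one hm i) (abs_nonneg _)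
      (F.weight_pos i).le
    simpa using this
  obtain ⟨i₀, hi₀⟩ := Finite.exists_min a
  obtain ⟨i₁, hi₁⟩ := Finite.exists_max a
  set κ := a i₀
  set q := a i₁
  -- On the base range `[lam₀, lam₀ / κ]` the Neumann count is at most `N` and the Dirichlet count
  -- at least 1, which fixes the constant.
  obtain ⟨N, hN⟩ := exists_hasNonposCodim μ₀ (L * (lam₀ / κ))
  refine ⟨lam₀, h0, N, ?_⟩
  -- Here `k` bounds the number of rescalings, each by a factor at most `q < 1`, that bring `lam`
  -- down to the base range.
  have step : ∀ k : ℕ, ∀ lam, lam₀ ≤ lam → lam * q ^ k ≤ lam₀ / κ →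
      ∃ n d, HasNonposCodim μ₀ (L * lam) n ∧ HasDirichletPosSpace μ₀ lam d ∧ n ≤ N * d := by
    intro k
    induction k with
    | zero =>
      intro lam hl hle
      exact ⟨N, 1, hN.anti (by gcongr; simpa using hle), hD.mono hl, by simp⟩
    | succ k ih =>
      intro lam hl hle
      by_cases hlt : lam ≤ lam₀ / κ
      · exact ⟨N, 1, hN.anti (by gcongr), hD.mono hl, by simp⟩
      have hlam : 0 < lam := h0.trans_le hl
      have : ∀ i, ∃ n d, HasNonposCodim μ₀ (L * (a i * lam)) n ∧
          HasDirichletPosSpace μ₀ (a i * lam) d ∧ n ≤ N * d := by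
        intro i
        refine ih _ ?_ ?_
        -- Above the base range, `a i * lam ≥ κ * lam > lam₀`, so rescaling never falls below
        -- `lam₀`.
        · rw [not_le, div_lt_iff₀ (ha0 i₀)] at hlt
          have := hi₀ i
          nlinarith
        · refine le_trans ?_ hle
          have h1 := hi₁ i
          have : 0 ≤ lam * q ^ k := by have := ha0 i₁; positivity
          calc a i * lam * q ^ k = a i * (lam * q ^ k) := by ring
            _ ≤ q * (lam * q ^ k) := by gcongr
            _ = _ := by ring
      choose n d hn hd hnd using this
      refine ⟨_, _, F.hasNonposCodim_sum h (n := n) fun i => ?_,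
        F.hasDirichletPosSpace_sum h (d := d) hd, ?_⟩
      · convert hn i using 1
        simp only [ha]
        ring
      · rw [Finset.mul_sum]
        exact Finset.sum_le_sum fun i _ => hnd i
  intro lam hl
  have hκ : 0 < lam₀ / κ := div_pos h0 (ha0 i₀)
  have hlam : 0 < lam := h0.trans_le hl
  obtain ⟨k, hk⟩ := exists_pow_lt_of_lt_one (div_pos hκ hlam) (ha1 i₁)
  refine step k lam hl ?_
  rw [lt_div_iff₀ hlam] at hk
  linarith

end AffineIFS

/-! ### Change of variables by a bi-Lipschitz homeomorphism. -/

theorem measurePreserving_coe_unitInterval :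
    MeasurePreserving (Subtype.val : I → ℝ) volume (volume.restrict (Icc (0 : ℝ) 1)) :=
  measurePreserving_subtype_coe measurableSet_Icc

theorem intervalIntegral_eq_setIntegral_unitInterval (f : ℝ → ℝ) {a b : I} (h : a ≤ b) :
    ∫ t in (a : ℝ)..b, f t = ∫ t in Icc a b, f t := by
  have := measurePreserving_coe_unitInterval.setIntegral_preimage_emb
    (MeasurableEmbedding.subtype_coe measurableSet_Icc) f (Icc (a : ℝ) b)
  rw [Measure.restrict_restrict_of_subset (Icc_subset_Icc a.2.1 b.2.2)] at this
  rw [intervalIntegral.integral_of_le h, ← integral_Icc_eq_integral_Ioc, ← this]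
  rfl

theorem integral_zero_one_eq_unitInterval (f : ℝ → ℝ) :
    ∫ t in (0 : ℝ)..1, f t = ∫ t : I, f t := by
  have := intervalIntegral_eq_setIntegral_unitInterval f (a := 0) (b := 1) zero_le_one
  have hu : Icc (0 : I) 1 = univ := eq_univ_of_forall fun x => ⟨x.2.1, x.2.2⟩
  rw [hu, Measure.restrict_univ] at this
  exact this

theorem MemSobolev.exists_lipschitzWith {f : I → ℝ} (h : MemSobolev ∞ f) :
    ∃ K : ℝ≥0, LipschitzWith K f := by
  obtain ⟨v, hv⟩ := h
  have hess : eLpNormEssSup v (volume.restrict (Icc (0 : ℝ) 1)) < ∞ := by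
    have := hv.1.2
    rwa [eLpNorm_exponent_top] at this
  refine ⟨(eLpNormEssSup v (volume.restrict (Icc (0 : ℝ) 1))).toNNReal,
    LipschitzWith.of_dist_le_mul fun a b => ?_⟩
  have hi := fun x => hv.intervalIntegrable le_top x
  rw [Real.dist_eq, hv.2 a, hv.2 b, add_sub_add_left_eq_sub,
    intervalIntegral.integral_interval_sub_left (hi a) (hi b), Subtype.dist_eq, Real.dist_eq]
  refine intervalIntegral.norm_integral_le_of_norm_le_const_ae (E := ℝ) ?_
  have hae := enorm_ae_le_eLpNormEssSup v (volume.restrict (Icc (0 : ℝ) 1))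
  rw [ae_restrict_iff' measurableSet_Icc] at hae
  filter_upwards [hae] with t ht htm
  have hm : t ∈ Icc (0 : ℝ) 1 := by
    have := uIoc_subset_uIcc htm
    exact (convex_Icc (0 : ℝ) 1).ordConnected.uIcc_subset b.2 a.2 this
  have h1 := ENNReal.toNNReal_mono hess.ne (ht hm)
  exact_mod_cast h1

/-- Lebesgue measure is one-dimensional Hausdorff measure, which a `K`-Lipschitz map enlarges at
most `K` times. -/
theorem map_symm_volume_le {g : I ≃ₜ I} {K : ℝ≥0} (hK : LipschitzWith K fun x => (g x : ℝ)) :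
    (volume : Measure I).map g.symm ≤ (K : ℝ≥0∞) • volume := by
  have hvol : ∀ E : Set I, MeasurableSet E → (volume : Measure I) E =
      volume (Subtype.val '' E) := fun E _ =>
    comap_subtype_coe_apply measurableSet_Icc volume E
  refine Measure.le_iff.2 fun E hE => ?_
  rw [Measure.map_apply g.symm.continuous.measurable hE, Measure.smul_apply, smul_eq_mul,
    hvol _ (g.symm.continuous.measurable hE), hvol E hE, ← g.image_eq_preimage_symm, image_image,
    ← hausdorffMeasure_real, isometry_subtype_coe.hausdorffMeasure_image (.inl zero_le_one) E]
  simpa using hK.hausdorffMeasure_image_le zero_le_one E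

theorem HasSobolevDeriv.congr_deriv {p : ℝ≥0∞} {y : I → ℝ} {v v' : ℝ → ℝ}
    (h : HasSobolevDeriv p y v) (hv : v =ᵐ[volume.restrict (Icc (0 : ℝ) 1)] v') :
    HasSobolevDeriv p y v' := by
  refine ⟨(memLp_congr_ae hv).1 h.1, fun x => ?_⟩
  rw [h.2 x]
  congr 1
  refine intervalIntegral.integral_congr_ae ?_
  rw [Filter.EventuallyEq, ae_restrict_iff' measurableSet_Icc] at hv
  filter_upwards [hv] with t ht htm
  rw [uIoc_of_le x.2.1] at htm
  exact ht ⟨htm.1.le, htm.2.trans x.2.2⟩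

/-- A genuinely measurable representative is wanted so that composition with `g` stays measurable.
-/
theorem HasSobolevDeriv.exists_measurable {y : I → ℝ} {v : ℝ → ℝ} (h : HasSobolevDeriv 2 y v) :
    ∃ v', Measurable v' ∧ HasSobolevDeriv 2 y v' ∧
      ∫ t in (0 : ℝ)..1, v' t ^ 2 = ∫ t in (0 : ℝ)..1, v t ^ 2 := by
  have hae := h.1.1.ae_eq_mk
  refine ⟨_, h.1.1.stronglyMeasurable_mk.measurable, h.congr_deriv hae, ?_⟩
  rw [intervalIntegral.integral_of_le zero_le_one, intervalIntegral.integral_of_le zero_le_one,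
    ← integral_Icc_eq_integral_Ioc, ← integral_Icc_eq_integral_Ioc]
  refine integral_congr_ae ?_
  filter_upwards [hae] with t ht
  rw [ht]

/-- Chain rule for a Sobolev function and a homeomorphism of `[0,1]` which is Lipschitz. -/
theorem HasSobolevDeriv.comp_homeomorph {g : I ≃ₜ I} {K : ℝ≥0}
    (hK : LipschitzWith K fun x => (g x : ℝ)) {y : I → ℝ} {v : ℝ → ℝ}
    (h : HasSobolevDeriv 2 y v) :
    ∃ w, HasSobolevDeriv 2 (fun x => y (g x)) w ∧
      ∫ t in (0 : ℝ)..1, w t ^ 2 ≤ K * ∫ t in (0 : ℝ)..1, v t ^ 2 := by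
  obtain ⟨v', hm, h', he⟩ := h.exists_measurable
  rw [← he]
  clear he h
  have hgs : MeasurePreserving g.symm (volume : Measure I) ((volume : Measure I).map g.symm) :=
    g.symm.continuous.measurable.measurePreserving _
  have hge : MeasurableEmbedding g.symm := g.symm.measurableEmbedding
  have hle := map_symm_volume_le hK
  set η := (volume : Measure I).map g.symm with hη
  have hfin : IsFiniteMeasure η := Measure.isFiniteMeasure_map _ _
  have hac : η ≪ volume := (Measure.absolutelyContinuous_of_le hle).trans
    (Measure.smul_absolutelyContinuous)
  -- This density of E ↦ |g(E)| plays the role of |g'| and avoids differentiating `g`.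
  set k : I → ℝ≥0∞ := η.rnDeriv volume with hk
  have hkm : Measurable k := Measure.measurable_rnDeriv _ _
  have hkK : ∀ᵐ t : I, k t ≤ K := by
    refine ae_le_of_forall_setLIntegral_le_of_sigmaFinite hkm fun s hs _ => ?_
    rw [Measure.setLIntegral_rnDeriv hac]
    simpa using hle s
  have hset : ∀ s : Set I, MeasurableSet s →
      ∫ t in s, (k t).toReal * v' (g t) = ∫ u in g.symm ⁻¹' s, v' u := by
    intro s hs
    have h1 := setIntegral_rnDeriv_smul hac hs (f := fun t => v' (g t))
    have h2 := hgs.setIntegral_preimage_emb hge (fun t => v' (g t)) s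
    simp only [Homeomorph.apply_symm_apply] at h2
    rw [h2, ← h1]
    rfl
  -- `sg` is the orientation of `g`, which is strictly monotone by injectivity and continuity.
  obtain ⟨sg, hsg, hinc⟩ : ∃ sg : ℝ, sg ^ 2 = 1 ∧ ∀ x : I, ∫ t in (g 0 : ℝ)..g x, v' t =
      sg * ∫ t in Icc 0 x, (k t).toReal * v' (g t) := by
    have hle0 : ∀ x : I, 0 ≤ x := fun x => x.2.1
    rcases g.continuous.strictMono_of_inj_boundedOrder' g.injective with hg | hg
    · refine ⟨1, by norm_num, fun x => ?_⟩
      have : g.symm ⁻¹' (Icc 0 x) = Icc (g 0) (g x) := by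
        rw [← g.image_eq_preimage_symm]
        exact (hg.orderIsoOfSurjective g g.surjective).image_Icc 0 x
      rw [hset _ measurableSet_Icc, this, one_mul,
        intervalIntegral_eq_setIntegral_unitInterval _ (hg.monotone (hle0 x))]
    · refine ⟨-1, by norm_num, fun x => ?_⟩
      have : g.symm ⁻¹' (Icc 0 x) = Icc (g x) (g 0) := by
        ext u
        have e1 : g.symm u ≤ x ↔ g x ≤ u := by
          rw [← hg.le_iff_ge, Homeomorph.apply_symm_apply]
        have e2 : 0 ≤ g.symm u ↔ u ≤ g 0 := by
          rw [← hg.le_iff_ge, Homeomorph.apply_symm_apply]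
        rw [mem_preimage, mem_Icc, mem_Icc, e1, e2, and_comm]
      rw [hset _ measurableSet_Icc, this, intervalIntegral.integral_symm,
        intervalIntegral_eq_setIntegral_unitInterval _ (hg.antitone (hle0 x))]
      ring
  let w₀ : I → ℝ := fun t => sg * ((k t).toReal * v' (g t))
  let w : ℝ → ℝ := fun t => w₀ (projIcc 0 1 zero_le_one t)
  have hw : ∀ t : I, w t = w₀ t := fun t => by simp only [w]; rw [projIcc_val]
  have hwm₀ : Measurable w₀ := by
    have := g.continuous.measurable
    fun_prop
  have hwm : Measurable w := hwm₀.comp continuous_projIcc.measurable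
  have hv2 : Integrable (fun t : I => v' (g t) ^ 2) η := by
    rw [← hgs.integrable_comp_emb hge]
    have h3 := (measurePreserving_coe_unitInterval.integrable_comp_emb
      (MeasurableEmbedding.subtype_coe measurableSet_Icc)).2 h'.1.integrable_sq
    refine h3.congr (Filter.Eventually.of_forall fun t => ?_)
    simp
  have hkv : Integrable (fun t : I => (k t).toReal * v' (g t) ^ 2) volume :=
    (integrable_rnDeriv_smul_iff hac).2 hv2
  -- One factor `k` is bounded by `K`; the other is kept as the Jacobian that turns the integral
  -- back into the energy of `y`.
  have hbound : ∀ᵐ t : I, w₀ t ^ 2 ≤ K * ((k t).toReal * v' (g t) ^ 2) := by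
    filter_upwards [hkK] with t ht
    have h1 : (k t).toReal ≤ K := by simpa using ENNReal.toReal_mono ENNReal.coe_ne_top ht
    have h0 : 0 ≤ (k t).toReal := ENNReal.toReal_nonneg
    simp only [w₀]
    calc (sg * ((k t).toReal * v' (g t))) ^ 2
        = (k t).toReal * ((k t).toReal * v' (g t) ^ 2) := by rw [mul_pow, hsg]; ring
      _ ≤ _ := by gcongr
  have hw2 : Integrable (fun t => w₀ t ^ 2) volume :=
    (hkv.const_mul K).mono' (hwm₀.pow_const 2).aestronglyMeasurable <| by
      filter_upwards [hbound] with t ht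
      rwa [Real.norm_of_nonneg (sq_nonneg _)]
  refine ⟨w, ⟨?_, fun x => ?_⟩, ?_⟩
  · rw [memLp_two_iff_integrable_sq hwm.aestronglyMeasurable,
      ← measurePreserving_coe_unitInterval.integrable_comp_emb
      (MeasurableEmbedding.subtype_coe measurableSet_Icc)]
    refine hw2.congr (Filter.Eventually.of_forall fun t => ?_)
    simp only [Function.comp_apply, hw]
  · have hi := fun x => h'.intervalIntegrable one_le_two x
    have h1 : y (g x) = y (g 0) + ∫ t in (g 0 : ℝ)..g x, v' t := by
      rw [h'.2 (g x), h'.2 (g 0),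
        ← intervalIntegral.integral_interval_sub_left (hi (g x)) (hi (g 0))]
      ring
    have h2 := intervalIntegral_eq_setIntegral_unitInterval w (a := 0) (b := x) x.2.1
    simp only [hw, w₀, integral_const_mul] at h2
    change y (g x) = y (g 0) + _
    rw [h1, hinc, ← h2]
    rfl
  · rw [integral_zero_one_eq_unitInterval, integral_zero_one_eq_unitInterval]
    simp only [hw]
    refine (integral_mono_ae hw2 (hkv.const_mul K) hbound).trans_eq ?_
    rw [integral_const_mul]
    congr 1
    have h1 := integral_rnDeriv_smul hac (f := fun t => v' (g t) ^ 2)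
    have h2 := hgs.integral_comp hge (fun t => v' (g t) ^ 2)
    simp only [Homeomorph.apply_symm_apply] at h2
    rw [h2, ← h1]
    rfl

theorem HasPosSpace.comp_homeomorph {ν : Measure I} {lam : ℝ} {d : ℕ} (h : HasPosSpace ν lam d)
    {g : I ≃ₜ I} {K : ℝ≥0} (hK : LipschitzWith K fun x => (g x : ℝ)) (hK0 : 0 < K) :
    HasPosSpace (ν.map g.symm) (K * lam) d := by
  obtain ⟨ψ, hψ⟩ := h
  refine ⟨LinearMap.funLeft ℝ ℝ g ∘ₗ ψ, fun c hc => ?_⟩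
  obtain ⟨v, hv, hlt⟩ := hψ c hc
  obtain ⟨w, hw, hle⟩ := hv.comp_homeomorph hK
  refine ⟨w, hw, hle.trans_lt ?_⟩
  have e : ∫ x, ((LinearMap.funLeft ℝ ℝ g ∘ₗ ψ) c x) ^ 2 ∂(ν.map g.symm) =
      ∫ x, ψ c x ^ 2 ∂ν := by
    rw [g.symm.measurableEmbedding.integral_map]
    simp [LinearMap.funLeft_apply]
  rw [e, mul_assoc]
  exact mul_lt_mul_of_pos_left hlt (by exact_mod_cast hK0)

/-! ### Compact symmetric operators. -/

section Hilbert

open scoped InnerProductSpace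

variable {E : Type*} [NormedAddCommGroup E] [InnerProductSpace ℝ E]

theorem inner_map_self_le_of_mem_iSup_eigenspace {T : E →L[ℝ] E}
    (hT : (T : E →ₗ[ℝ] E).IsSymmetric) {t : ℝ} {u : E}
    (hu : u ∈ ⨆ τ : {τ : ℝ // τ ≤ t}, Module.End.eigenspace (T : E →ₗ[ℝ] E) τ) :
    ⟪T u, u⟫_ℝ ≤ t * ‖u‖ ^ 2 := by
  obtain ⟨f, hf, rfl⟩ := (Submodule.mem_iSup_iff_exists_finsupp _ _).1 hu
  have horth : ∀ i j, i ≠ j → ⟪f i, f j⟫_ℝ = 0 := fun i j hij =>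
    hT.orthogonalFamily_eigenspaces (i := (i : ℝ)) (j := (j : ℝ))
      (fun h => hij (Subtype.ext h)) ⟨f i, hf i⟩ ⟨f j, hf j⟩
  have hTf : ∀ i, T (f i) = (i : ℝ) • f i := fun i => Module.End.mem_eigenspace_iff.1 (hf i)
  simp only [Finsupp.sum]
  have h1 : ⟪T (∑ i ∈ f.support, f i), ∑ i ∈ f.support, f i⟫_ℝ =
      ∑ i ∈ f.support, (i : ℝ) * ‖f i‖ ^ 2 := by
    rw [map_sum, sum_inner]
    refine Finset.sum_congr rfl fun i hi => ?_
    rw [inner_sum, Finset.sum_eq_single i, hTf, real_inner_smul_left, real_inner_self_eq_norm_sq]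
    · intro j _ hj
      rw [hTf, real_inner_smul_left, horth i j hj.symm, mul_zero]
    · exact fun h => absurd hi h
  have h2 : ‖∑ i ∈ f.support, f i‖ ^ 2 = ∑ i ∈ f.support, ‖f i‖ ^ 2 := by
    rw [← real_inner_self_eq_norm_sq, sum_inner]
    refine Finset.sum_congr rfl fun i hi => ?_
    rw [inner_sum, Finset.sum_eq_single i, real_inner_self_eq_norm_sq]
    · exact fun j _ hj => horth i j hj.symm
    · exact fun h => absurd hi h
  rw [h1, h2, Finset.mul_sum]
  exact Finset.sum_le_sum fun i _ => mul_le_mul_of_nonneg_right i.2 (sq_nonneg _)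

/-- The variational bound for a compact symmetric operator on the orthogonal complement of the
eigenspaces with large eigenvalues. -/
theorem inner_map_self_le_of_orthogonal_eigenspaces [CompleteSpace E] {T : E →L[ℝ] E}
    (hc : IsCompactOperator T) (hT : (T : E →ₗ[ℝ] E).IsSymmetric) {t : ℝ} {u : E}
    (hu : ∀ τ e, t < τ → T e = τ • e → ⟪e, u⟫_ℝ = 0) : ⟪T u, u⟫_ℝ ≤ t * ‖u‖ ^ 2 := by
  set V : Submodule ℝ E := ⨆ τ : {τ : ℝ // τ ≤ t}, Module.End.eigenspace (T : E →ₗ[ℝ] E) τ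
  set K := V.topologicalClosure
  have hKc : CompleteSpace K := V.isClosed_topologicalClosure.completeSpace_coe
  have hclosed : IsClosed {x : E | ⟪T x, x⟫_ℝ ≤ t * ‖x‖ ^ 2} :=
    isClosed_le (by fun_prop) (by fun_prop)
  have hK : ∀ x ∈ K, ⟪T x, x⟫_ℝ ≤ t * ‖x‖ ^ 2 := fun x hx =>
    closure_minimal (fun y hy => inner_map_self_le_of_mem_iSup_eigenspace hT hy) hclosed hx
  -- The part `r` is orthogonal to the low eigenspaces by construction and to the high ones by
  -- hypothesis, so it vanishes because the eigenspaces span a dense subspace.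
  obtain ⟨p, hp, r, hr, rfl⟩ := K.exists_add_mem_mem_orthogonal u
  have hr0 : r = 0 := by
    have hmem : r ∈ (⨆ τ, Module.End.eigenspace (T : Module.End ℝ E) τ)ᗮ := by
      rw [← Submodule.iInf_orthogonal, Submodule.mem_iInf]
      intro τ
      rw [Submodule.mem_orthogonal]
      intro e he
      rcases le_or_gt τ t with hτ | hτ
      · exact (Submodule.mem_orthogonal _ _).1 hr e (V.le_topologicalClosure
          (Submodule.mem_iSup_of_mem (p := fun τ : {τ : ℝ // τ ≤ t} =>
            Module.End.eigenspace (T : E →ₗ[ℝ] E) τ) ⟨τ, hτ⟩ he))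
      · have h1 := hu τ e hτ (Module.End.mem_eigenspace_iff.1 he)
        have h2 : ⟪e, p⟫_ℝ = 0 := by
          have hV : e ∈ Vᗮ := by
            rw [← Submodule.iInf_orthogonal, Submodule.mem_iInf]
            intro τ'
            rw [Submodule.mem_orthogonal]
            intro e' he'
            exact hT.orthogonalFamily_eigenspaces (i := (τ' : ℝ)) (j := τ)
              (τ'.2.trans_lt hτ).ne ⟨e', he'⟩ ⟨e, he⟩
          rw [← Submodule.orthogonal_closure] at hV
          rw [real_inner_comm]
          exact (Submodule.mem_orthogonal _ _).1 hV p hp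
        rwa [inner_add_right, h2, zero_add] at h1
    rw [ContinuousLinearMap.orthogonalComplement_iSup_eigenspaces_eq_bot hc hT] at hmem
    exact (Submodule.mem_bot ℝ).1 hmem
  rw [hr0, add_zero]
  exact hK p hp

theorem integral_mem_of_isClosed {F X : Type*} [NormedAddCommGroup F] [NormedSpace ℝ F]
    [CompleteSpace F] [TopologicalSpace X] [CompactSpace X] [MeasurableSpace X]
    [OpensMeasurableSpace X] [SecondCountableTopology X] (ν : Measure X) [IsFiniteMeasure ν]
    {C : Submodule ℝ F} (hC : IsClosed (C : Set F)) {R : X → F} (hR : Continuous R)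
    (hmem : ∀ x, R x ∈ C) : ∫ x, R x ∂ν ∈ C := by
  have : CompleteSpace C := hC.completeSpace_coe
  let R' : X → C := fun x => ⟨R x, hmem x⟩
  have hRi : Integrable R' ν := (hR.subtype_mk hmem).integrable_of_hasCompactSupport
    (HasCompactSupport.of_compactSpace _)
  have h1 : ∫ x, R x ∂ν = C.subtypeL (∫ x, R' x ∂ν) := (C.subtypeL.integral_comp_comm hRi)
  rw [h1]
  exact (∫ x, R' x ∂ν).2

/-- The integral of the rank one operators of a continuous family of vectors is compact. -/
theorem exists_compact_symmetric_of_kernel [CompleteSpace E] {X : Type*} [TopologicalSpace X]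
    [CompactSpace X] [MeasurableSpace X] [OpensMeasurableSpace X] [SecondCountableTopology X]
    (ν : Measure X) [IsFiniteMeasure ν] {κ : X → E} (hκ : Continuous κ) :
    ∃ T : E →L[ℝ] E, IsCompactOperator T ∧ (T : E →ₗ[ℝ] E).IsSymmetric ∧
      ∀ u w, ⟪T u, w⟫_ℝ = ∫ x, ⟪κ x, u⟫_ℝ * ⟪κ x, w⟫_ℝ ∂ν := by
  let R : X → E →L[ℝ] E := fun x => InnerProductSpace.rankOne ℝ (κ x) (κ x)
  have hRK : ∀ x, IsCompactOperator (R x) := by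
    intro x
    have h1 : IsCompactOperator (ContinuousLinearMap.toSpanSingleton ℝ (κ x)) :=
      isCompactOperator_of_locallyCompactSpace_rng _
    exact h1.comp_clm (innerSL ℝ (κ x))
  have hRc : Continuous R :=
    ((InnerProductSpace.rankOne ℝ).continuous.comp hκ).clm_apply hκ
  have hcompact : IsCompactOperator (∫ x, R x ∂ν : E →L[ℝ] E) :=
    integral_mem_of_isClosed ν (C := compactOperator (RingHom.id ℝ) E E)
      isClosed_setOfPred_isCompactOperator hRc hRK
  have hi : Integrable R ν := hRc.integrable_of_hasCompactSupport
    (HasCompactSupport.of_compactSpace _)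
  have hform : ∀ u w, ⟪(∫ x, R x ∂ν) u, w⟫_ℝ = ∫ x, ⟪κ x, u⟫_ℝ * ⟪κ x, w⟫_ℝ ∂ν := by
    intro u w
    have hiu : Integrable (fun x => R x u) ν :=
      (ContinuousLinearMap.apply ℝ E u).integrable_comp hi
    rw [ContinuousLinearMap.integral_apply hi, real_inner_comm, ← integral_inner hiu]
    refine integral_congr_ae (Filter.Eventually.of_forall fun x => ?_)
    simp only [R, InnerProductSpace.rankOne_apply, real_inner_smul_right]
    rw [real_inner_comm w]
  refine ⟨∫ x, R x ∂ν, hcompact, fun u w => ?_, hform⟩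
  rw [ContinuousLinearMap.coe_coe, hform, real_inner_comm, hform]
  simp only [mul_comm]

end Hilbert

/-! ### The kernel of the primitive. -/

section Kernel

open scoped InnerProductSpace

/-- The vectors of `L²(0,1)` representing the evaluations of the primitive. -/
def primitiveKernel (x : I) : Lp ℝ 2 (volume.restrict (Icc (0 : ℝ) 1)) :=
  indicatorConstLp 2 (measurableSet_Icc (a := (0 : ℝ)) (b := x)) (measure_ne_top _ _) 1

/-- The symmetric difference of [0,x] and [0,y] has length at most |x - y|. -/
theorem continuous_primitiveKernel : Continuous primitiveKernel := by
  refine continuous_indicatorConstLp_set (by simp) fun x => ?_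
  have hb : ∀ y : I, (volume.restrict (Icc (0 : ℝ) 1))
      (symmDiff (Icc (0 : ℝ) y) (Icc 0 x)) ≤ ENNReal.ofReal |(y : ℝ) - x| := by
    intro y
    refine (Measure.restrict_apply_le _ _).trans ?_
    have : symmDiff (Icc (0 : ℝ) y) (Icc 0 x) ⊆ uIcc (y : ℝ) x := by
      rintro t (⟨h1, h2⟩ | ⟨h1, h2⟩)
      · rw [mem_Icc, not_and, not_le] at h2
        exact mem_uIcc_of_ge (h2 h1.1).le h1.2
      · rw [mem_Icc, not_and, not_le] at h2
        exact mem_uIcc_of_le (h2 h1.1).le h1.2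
    refine (measure_mono this).trans_eq ?_
    rw [Real.volume_interval, abs_sub_comm]
  refine tendsto_of_tendsto_of_tendsto_of_le_of_le tendsto_const_nhds ?_ (fun _ => zero_le) hb
  have : Continuous fun y : I => ENNReal.ofReal |(y : ℝ) - x| :=
    ENNReal.continuous_ofReal.comp (by fun_prop)
  simpa using this.tendsto x

theorem inner_primitiveKernel (x : I) (u : Lp ℝ 2 (volume.restrict (Icc (0 : ℝ) 1))) :
    ⟪primitiveKernel x, u⟫_ℝ = ∫ t in (0 : ℝ)..x, u t := by
  rw [primitiveKernel, L2.inner_indicatorConstLp_one, intervalIntegral.integral_of_le x.2.1,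
    ← integral_Icc_eq_integral_Ioc,
    Measure.restrict_restrict_of_subset (Icc_subset_Icc_right x.2.2)]

end Kernel

/-! ### Eigenfunctions span a space of small energy. -/

section Eigenfunctions

/-- Testing each equation against the other solution gives the same energy pairing with two
different factors. -/
theorem IsNeumannSolution.integral_mul_eq_zero {ν : Measure I} {s s' : ℝ} {y z : I → ℝ}
    (hy : IsNeumannSolution ν s y) (hz : IsNeumannSolution ν s' z) (hs : s ≠ s') :
    ∫ x, y x * z x ∂ν = 0 := by
  obtain ⟨v, hv, hy⟩ := hy
  obtain ⟨w, hw, hz⟩ := hz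
  have h1 := hy z w hw
  have h2 := hz y v hv
  simp only [mul_comm (w _), mul_comm (z _)] at h2
  rw [h1] at h2
  have : (s - s') * ∫ x, y x * z x ∂ν = 0 := by linarith
  exact (mul_eq_zero.1 this).resolve_left (sub_ne_zero.2 hs)

theorem HasSobolevDeriv.eq_zero_of_energy {ν : Measure I} [IsProbabilityMeasure ν] {y : I → ℝ}
    {v : ℝ → ℝ} (h : HasSobolevDeriv 2 y v) (hE : ∫ t in (0 : ℝ)..1, v t ^ 2 = 0)
    (hy : ∫ x, y x ^ 2 ∂ν = 0) : y = 0 := by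
  have hc : ∀ x, y x = y 0 := by
    intro x
    have := h.sq_sub_le x 0
    rw [hE, mul_zero] at this
    exact sub_eq_zero.1 (pow_eq_zero_iff two_ne_zero |>.1 (le_antisymm this (sq_nonneg _)))
  have h0 : y 0 = 0 := by
    simp only [hc] at hy
    simpa using hy
  ext x
  rw [hc, h0]
  rfl

theorem IsNeumannSolution.integral_sq_pos {ν : Measure I} [IsProbabilityMeasure ν] {s : ℝ}
    {y : I → ℝ} (hy : IsNeumannSolution ν s y) (h0 : y ≠ 0) : 0 < ∫ x, y x ^ 2 ∂ν := by
  refine (integral_nonneg fun x => sq_nonneg _).lt_of_ne fun he => h0 ?_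
  obtain ⟨v, hv, hy⟩ := hy
  refine hv.eq_zero_of_energy ?_ he.symm
  have := hy y v hv
  simp only [← pow_two] at this
  rw [this, ← he, mul_zero]

/-- Orthogonality diagonalises both forms: the mass is Σ m_i and the energy Σ s_i m_i, with m_i > 0
for each nonzero summand. -/
theorem exists_energy_lt_of_sum_isNeumannSolution {ν : Measure I} [IsProbabilityMeasure ν]
    {lam : ℝ} {ι : Type*} [Fintype ι] {s : ι → ℝ} (hs : ∀ i, s i < lam)
    (hinj : Function.Injective s) {y : ι → I → ℝ} (hy : ∀ i, IsNeumannSolution ν (s i) (y i))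
    (h0 : ∃ i, y i ≠ 0) :
    ∃ v, HasSobolevDeriv 2 (∑ i, y i) v ∧
      ∫ t in (0 : ℝ)..1, v t ^ 2 < lam * ∫ x, (∑ i, y i) x ^ 2 ∂ν := by
  have hy' := hy
  choose v hv hsol using hy
  have hW : HasSobolevDeriv 2 (∑ i, y i) (fun t => ∑ i, v i t) := by
    constructor
    · exact memLp_finsetSum _ fun i _ => (hv i).1
    · intro x
      rw [intervalIntegral.integral_finsetSum fun i _ => (hv i).intervalIntegrable one_le_two x,
        Finset.sum_apply, Finset.sum_apply, ← Finset.sum_add_distrib]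
      exact Finset.sum_congr rfl fun i _ => (hv i).2 x
  have hmass : ∀ i, ∫ x, y i x * (∑ j, y j) x ∂ν = ∫ x, y i x ^ 2 ∂ν := by
    intro i
    simp only [Finset.sum_apply, Finset.mul_sum]
    rw [integral_finsetSum _ fun j _ => (hv i).integrable_mul ν (hv j),
      Finset.sum_eq_single i]
    · simp only [pow_two]
    · exact fun j _ hj => (hy' i).integral_mul_eq_zero (hy' j) (hinj.ne hj.symm)
    · simp
  have hE : ∫ t in (0 : ℝ)..1, (∑ i, v i t) ^ 2 = ∑ i, s i * ∫ x, y i x ^ 2 ∂ν := by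
    simp only [pow_two (∑ i, v i _), Finset.sum_mul]
    rw [intervalIntegral.integral_finsetSum fun i _ => (hv i).intervalIntegrable_mul hW]
    exact Finset.sum_congr rfl fun i _ => by rw [hsol i _ _ hW, hmass]
  have hM : ∫ x, (∑ i, y i) x ^ 2 ∂ν = ∑ i, ∫ x, y i x ^ 2 ∂ν := by
    have : ∀ x, (∑ i, y i) x ^ 2 = ∑ i, y i x * (∑ j, y j) x := fun x => by
      rw [← Finset.sum_mul, pow_two, Finset.sum_apply]
    simp only [this]
    rw [integral_finsetSum _ fun j _ => (hv j).integrable_mul ν hW]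
    exact Finset.sum_congr rfl fun i _ => hmass i
  refine ⟨_, hW, ?_⟩
  rw [hE, hM, Finset.mul_sum]
  obtain ⟨i, hi⟩ := h0
  refine Finset.sum_lt_sum (fun i _ => ?_) ⟨i, Finset.mem_univ _, ?_⟩
  · have : 0 ≤ ∫ x, y i x ^ 2 ∂ν := integral_nonneg fun x => sq_nonneg _
    have := (hs i).le
    gcongr
  · exact mul_lt_mul_of_pos_right (hs i) ((hy' i).integral_sq_pos hi)

theorem hasPosSpace_of_le_countingFunction {ν : Measure I} [IsProbabilityMeasure ν] {lam : ℝ}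
    {d : ℕ} (h : (d : ℕ∞) ≤ countingFunction lam ν) : HasPosSpace ν lam d := by
  classical
  obtain ⟨Q', hQ', hcard⟩ := Set.exists_subset_encard_eq h
  have hfin : Q'.Finite := Set.finite_of_encard_eq_coe hcard
  set Q := hfin.toFinset
  have hQ : ∀ q ∈ Q, q.1 < lam ∧ (q.2 : Cardinal) < Module.rank ℝ (eigenspace ν q.1) :=
    fun q hq => hQ' (hfin.mem_toFinset.1 hq)
  have hQd : Q.card = d := by
    rw [hfin.encard_eq_coe_toFinset_card] at hcard
    exact_mod_cast hcard
  set S₀ := Q.image Prod.fst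
  -- Only finitely many pairs are selected, so a `k s`-dimensional piece of each eigenspace is
  -- enough, even if finiteness of the multiplicity is not yet known.
  let k : ℝ → ℕ := fun s => (Q.filter fun q => q.1 = s).card
  have hk : ∀ s ∈ S₀, (k s : Cardinal) ≤ Module.rank ℝ (eigenspace ν s) := by
    intro s _
    by_contra! hlt
    obtain ⟨r, hr⟩ := Cardinal.lt_aleph0.1 (hlt.trans Cardinal.natCast_lt_aleph0)
    rw [hr, Nat.cast_lt] at hlt
    refine hlt.not_ge ?_
    have hle := Finset.card_le_card_of_injOn (s := Q.filter fun q => q.1 = s)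
      (t := Finset.range r) Prod.snd ?_ ?_
    · simpa using hle
    · intro q hq
      have hq' := Finset.mem_filter.1 (Finset.mem_coe.1 hq)
      have := (hQ q hq'.1).2
      rw [hq'.2, hr, Nat.cast_lt] at this
      simpa using this
    · intro q hq q' hq' he
      have h1 := Finset.mem_filter.1 (Finset.mem_coe.1 hq)
      have h2 := Finset.mem_filter.1 (Finset.mem_coe.1 hq')
      exact Prod.ext (h1.2.trans h2.2.symm) he
  choose f hf using fun s : S₀ => Module.le_rank_iff_exists_linearMap.1 (hk s s.2)
  refine hasPosSpace_of_finrank (X := ∀ s : S₀, Fin (k s) → ℝ) ?_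
    (∑ s : S₀, (eigenspace ν s).subtype ∘ₗ f s ∘ₗ LinearMap.proj s) fun c hc => ?_
  · rw [Module.finrank_pi_fintype]
    simp only [Module.finrank_fin_fun]
    rw [← hQd, Finset.card_eq_sum_card_image Prod.fst Q]
    exact Finset.sum_coe_sort S₀ k
  · have hsum : (∑ s : S₀, (eigenspace ν s).subtype ∘ₗ f s ∘ₗ LinearMap.proj s) c =
        ∑ s : S₀, (f s (c s) : I → ℝ) := by
      simp
    rw [hsum]
    refine exists_energy_lt_of_sum_isNeumannSolution (s := fun s : S₀ => (s : ℝ)) (fun s => ?_)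
      Subtype.val_injective (fun s => (f s (c s)).2) ?_
    · obtain ⟨q, hq, he⟩ := Finset.mem_image.1 s.2
      rw [← he]
      exact (hQ q hq).1
    · obtain ⟨s, hs⟩ := Function.ne_iff.1 hc
      refine ⟨s, fun h0 => hs ?_⟩
      exact hf s ((Subtype.ext h0).trans (map_zero _).symm)

end Eigenfunctions

/-! ### Orthogonality to low eigenfunctions bounds the mass. -/

section Spectral

open scoped InnerProductSpace

theorem hasSobolevDeriv_toLp {y : I → ℝ} {v : ℝ → ℝ} (h : HasSobolevDeriv 2 y v) :
    HasSobolevDeriv 2 y (h.1.toLp v) :=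
  h.congr_deriv h.1.coeFn_toLp.symm

theorem inner_lp_eq_intervalIntegral (u w : Lp ℝ 2 (volume.restrict (Icc (0 : ℝ) 1))) :
    ⟪u, w⟫_ℝ = ∫ t in (0 : ℝ)..1, u t * w t := by
  rw [L2.inner_def, intervalIntegral.integral_of_le zero_le_one, ← integral_Icc_eq_integral_Ioc]
  simp [mul_comm]

/-- A ν-mean-zero function is determined by its derivative `u` in L², and its mass is ⟨Tu, u⟩ for a
compact symmetric `T`. Eigenvectors of `T` for τ > 0 are derivatives of Neumann solutions for 1/τ,
so the bound is that of `T` off its eigenvalues above 1/`lam`. -/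
theorem mass_le_energy_of_orthogonal {ν : Measure I} [IsProbabilityMeasure ν] {lam : ℝ}
    (hlam : 0 < lam) {y : I → ℝ} {v : ℝ → ℝ} (hv : HasSobolevDeriv 2 y v)
    (h : ∀ s z, s < lam → IsNeumannSolution ν s z → ∫ x, y x * z x ∂ν = 0) :
    lam * ∫ x, y x ^ 2 ∂ν ≤ ∫ t in (0 : ℝ)..1, v t ^ 2 := by
  have hint : Integrable primitiveKernel ν :=
    continuous_primitiveKernel.integrable_of_hasCompactSupport (HasCompactSupport.of_compactSpace _)
  set κm := ∫ x, primitiveKernel x ∂ν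
  -- Subtracting the average kernel `κm` selects the primitive of ν-mean zero.
  let κ : I → Lp ℝ 2 (volume.restrict (Icc (0 : ℝ) 1)) := fun x => primitiveKernel x - κm
  have hκc : Continuous κ := continuous_primitiveKernel.sub continuous_const
  have hκ : ∀ x u, ⟪κ x, u⟫_ℝ = (∫ t in (0 : ℝ)..x, u t) - ⟪κm, u⟫_ℝ := fun x u => by
    rw [inner_sub_left, inner_primitiveKernel]
  have hκ0 : ∀ u, ∫ x, ⟪κ x, u⟫_ℝ ∂ν = 0 := by
    intro u
    have hi : Integrable κ ν := hint.sub (integrable_const _)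
    have h1 : ∫ x, κ x ∂ν = 0 := by
      have : ∫ x, κ x ∂ν = κm - ∫ _x, κm ∂ν := integral_sub hint (integrable_const _)
      rw [this]
      simp
    simp only [real_inner_comm u]
    rw [integral_inner hi, h1, inner_zero_right]
  obtain ⟨T, hTc, hTs, hT⟩ := exists_compact_symmetric_of_kernel ν hκc
  have hprim : ∀ u, HasSobolevDeriv 2 (fun x => ⟪κ x, u⟫_ℝ) u := by
    refine fun u => ⟨Lp.memLp u, fun x => ?_⟩
    simp only [hκ]
    simp
    ring
  have hdecomp : ∀ η w, ∀ hw : HasSobolevDeriv 2 η w,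
      ∀ x, η x = ⟪κ x, hw.1.toLp w⟫_ℝ + (η 0 + ⟪κm, hw.1.toLp w⟫_ℝ) := by
    intro η w hw x
    rw [hκ, (hasSobolevDeriv_toLp hw).2 x]
    ring
  have hpair : ∀ e η w, ∀ hw : HasSobolevDeriv 2 η w,
      ∫ x, ⟪κ x, e⟫_ℝ * η x ∂ν = ⟪T e, hw.1.toLp w⟫_ℝ := by
    intro e η w hw
    have hi1 := (hprim e).integrable_mul ν (hprim (hw.1.toLp w))
    have hi2 : Integrable (fun x => ⟪κ x, e⟫_ℝ) ν :=
      ((hprim e).continuous one_le_two).integrable_of_hasCompactSupport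
        (HasCompactSupport.of_compactSpace _)
    have hsplit : ∀ x, ⟪κ x, e⟫_ℝ * η x = ⟪κ x, e⟫_ℝ * ⟪κ x, hw.1.toLp w⟫_ℝ +
        ⟪κ x, e⟫_ℝ * (η 0 + ⟪κm, hw.1.toLp w⟫_ℝ) := fun x => by
      rw [← mul_add, ← hdecomp η w hw x]
    rw [hT, integral_congr_ae (Filter.Eventually.of_forall hsplit)]
    rw [integral_add hi1 (hi2.mul_const _), integral_mul_const, hκ0, zero_mul, add_zero]
  have henergy : ∀ e η w, ∀ hw : HasSobolevDeriv 2 η w,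
      ∫ t in (0 : ℝ)..1, e t * w t =
        ⟪(e : Lp ℝ 2 (volume.restrict (Icc (0 : ℝ) 1))), hw.1.toLp w⟫_ℝ := by
    intro e η w hw
    rw [inner_lp_eq_intervalIntegral, intervalIntegral.integral_of_le zero_le_one,
      intervalIntegral.integral_of_le zero_le_one, ← integral_Icc_eq_integral_Ioc,
      ← integral_Icc_eq_integral_Ioc]
    refine integral_congr_ae ?_
    filter_upwards [hw.1.coeFn_toLp] with t ht
    rw [ht]
  set u := hv.1.toLp v with hu
  have hconst : IsNeumannSolution ν 0 1 := ⟨0, ⟨MemLp.zero, by simp⟩, by simp⟩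
  -- Constants solve the problem for s = 0 < `lam`, so orthogonality to them removes the mean.
  have hmean : y 0 + ⟪κm, u⟫_ℝ = 0 := by
    have h1 := h 0 1 hlam hconst
    simp only [Pi.one_apply, mul_one] at h1
    rw [integral_congr_ae (Filter.Eventually.of_forall (hdecomp y v hv)), integral_add _ (integrable_const _), hκ0] at h1
    · simpa using h1
    · exact ((hprim u).continuous one_le_two).integrable_of_hasCompactSupport
        (HasCompactSupport.of_compactSpace _)
  have hy : ∀ x, y x = ⟪κ x, u⟫_ℝ := fun x => by rw [hdecomp y v hv, ← hu, hmean, add_zero]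
  have hmass : ∫ x, y x ^ 2 ∂ν = ⟪T u, u⟫_ℝ := by
    rw [hT]
    simp only [hy, pow_two]
  have hen : ∫ t in (0 : ℝ)..1, v t ^ 2 = ‖u‖ ^ 2 := by
    rw [← real_inner_self_eq_norm_sq, ← henergy u y v hv]
    rw [intervalIntegral.integral_of_le zero_le_one, intervalIntegral.integral_of_le zero_le_one,
      ← integral_Icc_eq_integral_Ioc, ← integral_Icc_eq_integral_Ioc]
    refine integral_congr_ae ?_
    filter_upwards [hv.1.coeFn_toLp] with t ht
    rw [hu, ht, pow_two]
  have key : ⟪T u, u⟫_ℝ ≤ lam⁻¹ * ‖u‖ ^ 2 := by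
    refine inner_map_self_le_of_orthogonal_eigenspaces hTc hTs fun τ e hτ he => ?_
    have hτ0 : 0 < τ := (inv_pos.2 hlam).trans hτ
    have hsol : IsNeumannSolution ν τ⁻¹ (fun x => ⟪κ x, e⟫_ℝ) := by
      refine ⟨e, hprim e, fun η w hw => ?_⟩
      rw [hpair e η w hw, henergy e η w hw, he, real_inner_smul_left, inv_mul_cancel_left₀ hτ0.ne']
    have h1 := h _ _ (inv_lt_of_inv_lt₀ hlam hτ) hsol
    simp only [mul_comm (y _)] at h1
    rw [hpair e y v hv, he, real_inner_smul_left] at h1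
    exact (mul_eq_zero.1 h1).resolve_left hτ0.ne'
  rw [hmass, hen]
  calc lam * ⟪T u, u⟫_ℝ ≤ lam * (lam⁻¹ * ‖u‖ ^ 2) := by gcongr
    _ = ‖u‖ ^ 2 := by field_simp

/-- `HasNonposCodim` asks for functionals on all functions; integration is linear on continuous ones
and is extended algebraically. -/
theorem exists_linearMap_eq_integral_mul (ν : Measure I) [IsFiniteMeasure ν] {e : I → ℝ}
    (he : Continuous e) :
    ∃ ℓ : (I → ℝ) →ₗ[ℝ] ℝ, ∀ y, Continuous y → ℓ y = ∫ x, y x * e x ∂ν := by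
  have hi : ∀ y : I → ℝ, Continuous y → Integrable (fun x => y x * e x) ν := fun y hy =>
    (hy.mul he).integrable_of_hasCompactSupport (HasCompactSupport.of_compactSpace _)
  let p : Submodule ℝ (I → ℝ) :=
    { carrier := {y | Continuous y}
      zero_mem' := continuous_zero
      add_mem' := fun ha hb => ha.add hb
      smul_mem' := fun c _ ha => ha.const_smul c }
  let ℓ : p →ₗ[ℝ] ℝ :=
    { toFun := fun y => ∫ x, (y : I → ℝ) x * e x ∂ν
      map_add' := fun a b => by
        rw [← integral_add (hi a a.2) (hi b b.2)]
        simp [add_mul]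
      map_smul' := fun c a => by
        rw [RingHom.id_apply, smul_eq_mul, ← integral_const_mul]
        simp [mul_assoc] }
  obtain ⟨ℓ', hℓ⟩ := LinearMap.exists_extend ℓ
  exact ⟨ℓ', fun y hy => LinearMap.congr_fun hℓ ⟨y, hy⟩⟩

/-- Each counted pair (s, k) gives one condition: orthogonality to the k-th basis vector of the
eigenspace of s. Together they give orthogonality to every eigenspace below `lam`. -/
theorem hasNonposCodim_of_countingFunction_eq {ν : Measure I} [IsProbabilityMeasure ν] {lam : ℝ}
    {n : ℕ} (h : countingFunction lam ν = n) : HasNonposCodim ν lam n := by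
  rcases le_or_gt lam 0 with hlam | hlam
  · obtain ⟨φ, hφ⟩ := hasNonposCodim_zero (ν := ν) hlam
    exact ⟨0, fun y v hv _ => hφ y v hv (Subsingleton.elim _ _)⟩
  rw [countingFunction] at h
  set Q : Set (ℝ × ℕ) :=
    {q : ℝ × ℕ | q.1 < lam ∧ (q.2 : Cardinal) < Module.rank ℝ (eigenspace ν q.1)} with hQ
  have hfin : Q.Finite := Set.finite_of_encard_eq_coe h
  have : Fintype Q := hfin.fintype
  -- An infinite multiplicity would contribute infinitely many pairs.
  have hrank : ∀ s < lam, Module.Finite ℝ (eigenspace ν s) := by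
    intro s hs
    rw [← Module.rank_lt_aleph0_iff]
    by_contra! hle
    refine Set.infinite_of_injective_forall_mem (s := Q) (f := fun k : ℕ => (s, k))
      (fun a b hab => (Prod.ext_iff.1 hab).2) (fun k => ⟨hs, ?_⟩) hfin
    exact Cardinal.natCast_lt_aleph0.trans_le hle
  have hex : ∀ q : Q, ∃ e : I → ℝ, e ∈ eigenspace ν q.1.1 ∧
      ∀ _ : Module.Finite ℝ (eigenspace ν q.1.1), ∀ hk : q.1.2 < Module.finrank ℝ
        (eigenspace ν q.1.1), e = Module.finBasis ℝ (eigenspace ν q.1.1) ⟨q.1.2, hk⟩ := by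
    intro q
    have := hrank _ q.2.1
    have hk : q.1.2 < Module.finrank ℝ (eigenspace ν q.1.1) := by
      have := q.2.2
      rw [← Module.finrank_eq_rank] at this
      exact_mod_cast this
    exact ⟨Module.finBasis ℝ (eigenspace ν q.1.1) ⟨q.1.2, hk⟩, Subtype.coe_prop _,
      fun _ _ => rfl⟩
  choose e he heb using hex
  have hec : ∀ q, Continuous (e q) := fun q => by
    obtain ⟨w, hw, _⟩ := he q
    exact hw.continuous one_le_two
  choose ℓ hℓ using fun q => exists_linearMap_eq_integral_mul ν (hec q)
  refine hasNonposCodim_of_finrank (X := Q → ℝ) ?_ (LinearMap.pi ℓ) fun y v hv h0 => ?_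
  · rw [Module.finrank_fintype_fun_eq_card, ← Set.toFinset_card]
    rw [Set.encard_eq_coe_toFinset_card] at h
    exact_mod_cast h
  refine mass_le_energy_of_orthogonal hlam hv fun s z hs hz => ?_
  have hfd := hrank s hs
  obtain ⟨ℓy, hℓy⟩ := exists_linearMap_eq_integral_mul ν (hv.continuous one_le_two)
  have hzero : ℓy ∘ₗ (eigenspace ν s).subtype = 0 := by
    refine (Module.finBasis ℝ (eigenspace ν s)).ext fun i => ?_
    have hq : (s, (i : ℕ)) ∈ Q := by
      refine ⟨hs, ?_⟩
      rw [← Module.finrank_eq_rank]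
      exact_mod_cast i.2
    have h1 := congrFun h0 ⟨(s, (i : ℕ)), hq⟩
    rw [LinearMap.pi_apply, hℓ _ _ (hv.continuous one_le_two), heb _ hfd i.2] at h1
    have hc : Continuous (Module.finBasis ℝ (eigenspace ν s) i : I → ℝ) := by
      obtain ⟨w, hw, _⟩ := (Module.finBasis ℝ (eigenspace ν s) i).2
      exact hw.continuous one_le_two
    simp only [LinearMap.comp_apply, Submodule.subtype_apply, LinearMap.zero_apply]
    rw [hℓy _ hc]
    simp only [mul_comm _ (y _)]
    exact h1
  have hz0 := LinearMap.congr_fun hzero ⟨z, hz⟩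
  have hzc : Continuous z := by
    obtain ⟨w, hw, _⟩ := hz
    exact hw.continuous one_le_two
  simp only [LinearMap.comp_apply, Submodule.subtype_apply, LinearMap.zero_apply] at hz0
  rw [hℓy _ hzc] at hz0
  simp only [mul_comm (y _)]
  exact hz0

end Spectral

/-! ### The counting function: finiteness, monotonicity, doubling, comparison. -/

theorem countingFunction_le_of_hasNonposCodim {ν : Measure I} [IsProbabilityMeasure ν] {lam : ℝ}
    {n : ℕ} (h : HasNonposCodim ν lam n) : countingFunction lam ν ≤ n := by
  refine ENat.forall_natCast_le_iff_le.1 fun d hd => ?_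
  exact_mod_cast (hasPosSpace_of_le_countingFunction hd).le h

theorem countingFunction_ne_top (ν : Measure I) [IsProbabilityMeasure ν] (lam : ℝ) :
    countingFunction lam ν ≠ ⊤ := by
  obtain ⟨n, hn⟩ := exists_hasNonposCodim ν lam
  exact ((countingFunction_le_of_hasNonposCodim hn).trans_lt (ENat.natCast_lt_top n)).ne

theorem toNat_countingFunction_le {ν : Measure I} [IsProbabilityMeasure ν] {lam : ℝ} {n : ℕ}
    (h : HasNonposCodim ν lam n) : (countingFunction lam ν).toNat ≤ n :=
  ENat.toNat_le_of_le_natCast (countingFunction_le_of_hasNonposCodim h)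

theorem hasPosSpace_countingFunction (ν : Measure I) [IsProbabilityMeasure ν] (lam : ℝ) :
    HasPosSpace ν lam (countingFunction lam ν).toNat :=
  hasPosSpace_of_le_countingFunction (ENat.natCast_toNat_le_self _)

theorem hasNonposCodim_countingFunction (ν : Measure I) [IsProbabilityMeasure ν] (lam : ℝ) :
    HasNonposCodim ν lam (countingFunction lam ν).toNat :=
  hasNonposCodim_of_countingFunction_eq (ENat.natCast_toNat (countingFunction_ne_top ν lam)).symm

theorem HasPosSpace.le_countingFunction {ν : Measure I} [IsProbabilityMeasure ν] {lam : ℝ} {d : ℕ}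
    (h : HasPosSpace ν lam d) : d ≤ (countingFunction lam ν).toNat :=
  h.le (hasNonposCodim_countingFunction ν lam)

theorem toNat_countingFunction_mono (ν : Measure I) [IsProbabilityMeasure ν] {lam lam' : ℝ}
    (h : lam ≤ lam') : (countingFunction lam ν).toNat ≤ (countingFunction lam' ν).toNat :=
  toNat_countingFunction_le ((hasNonposCodim_countingFunction ν lam').anti h)

theorem one_le_toNat_countingFunction (ν : Measure I) [IsProbabilityMeasure ν] {lam : ℝ}
    (h : 0 < lam) : 1 ≤ (countingFunction lam ν).toNat :=
  (hasPosSpace_one h).le_countingFunction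

theorem toNat_countingFunction_eq_zero (ν : Measure I) [IsProbabilityMeasure ν] {lam : ℝ}
    (h : lam ≤ 0) : (countingFunction lam ν).toNat = 0 :=
  Nat.le_zero.1 (toNat_countingFunction_le (hasNonposCodim_zero h))

/-- The doubling property of the counting function of a self-similar measure. -/
theorem AffineIFS.exists_countingFunction_mul_le {m : ℕ} (F : AffineIFS m) (hm : 2 ≤ m)
    {μ₀ : Measure I} [IsProbabilityMeasure μ₀] (h : IsSelfSimilarMeasure F μ₀) {L : ℝ}
    (hL : 0 < L) :
    ∃ C : ℕ, ∀ lam, (countingFunction (L * lam) μ₀).toNat ≤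
      C * (countingFunction lam μ₀).toNat := by
  obtain ⟨lam₀, h0, C, hC⟩ := F.exists_neumann_le_mul_dirichlet hm h hL
  refine ⟨max C (countingFunction (L * lam₀) μ₀).toNat, fun lam => ?_⟩
  rcases le_or_gt lam 0 with hl | hl
  · rw [toNat_countingFunction_eq_zero μ₀ (mul_nonpos_of_nonneg_of_nonpos hL.le hl)]
    exact Nat.zero_le _
  rcases le_total lam lam₀ with hle | hle
  -- Below `lam₀` the left side is bounded, while the count at `lam > 0` is at least 1 because of
  -- the constants.
  · calc (countingFunction (L * lam) μ₀).toNat ≤ (countingFunction (L * lam₀) μ₀).toNat :=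
          toNat_countingFunction_mono μ₀ (by gcongr)
      _ ≤ max C (countingFunction (L * lam₀) μ₀).toNat * 1 := by
          rw [mul_one]; exact le_max_right _ _
      _ ≤ _ := Nat.mul_le_mul_left _ (one_le_toNat_countingFunction μ₀ hl)
  · obtain ⟨n, d, hn, hd, hnd⟩ := hC lam hle
    calc (countingFunction (L * lam) μ₀).toNat ≤ n := toNat_countingFunction_le hn
      _ ≤ C * d := hnd
      _ ≤ _ := Nat.mul_le_mul (le_max_left _ _) hd.hasPosSpace.le_countingFunction

theorem IsSobolevDiffeo.exists_lipschitzWith {g : I ≃ₜ I} (hg : IsSobolevDiffeo g) :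
    ∃ K : ℝ≥0, 0 < K ∧ LipschitzWith K (fun x => (g x : ℝ)) ∧
      LipschitzWith K (fun x => (g.symm x : ℝ)) := by
  obtain ⟨K₁, h1⟩ := hg.1.exists_lipschitzWith
  obtain ⟨K₂, h2⟩ := hg.2.exists_lipschitzWith
  exact ⟨K₁ + K₂ + 1, by positivity, h1.weaken (by rw [add_assoc]; exact le_self_add),
    h2.weaken (by rw [add_comm K₁, add_assoc]; exact le_self_add)⟩

end

theorem theorem1 {m : ℕ} (hm : 2 ≤ m) (F : AffineIFS m) (μ₀ : Measure I)
    [IsProbabilityMeasure μ₀] (hμ₀ : IsSelfSimilarMeasure F μ₀)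
    (g : I ≃ₜ I) (hg : IsSobolevDiffeo g) :
    (∀ lam : ℝ, countingFunction lam μ₀ ≠ ⊤ ∧
      countingFunction lam (deformedMeasure μ₀ g) ≠ ⊤) ∧
    ∃ C₁ C₂ : ℝ, 0 < C₁ ∧ 0 < C₂ ∧ ∀ lam : ℝ, 0 ≤ lam →
      C₁ * ((countingFunction lam μ₀).toNat : ℝ) ≤
          ((countingFunction lam (deformedMeasure μ₀ g)).toNat : ℝ) ∧
        ((countingFunction lam (deformedMeasure μ₀ g)).toNat : ℝ) ≤
          C₂ * ((countingFunction lam μ₀).toNat : ℝ) := by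
  have hprob : IsProbabilityMeasure (deformedMeasure μ₀ g) :=
    Measure.isProbabilityMeasure_map g.symm.continuous.aemeasurable
  refine ⟨fun lam => ⟨countingFunction_ne_top _ _, countingFunction_ne_top _ _⟩, ?_⟩
  obtain ⟨K, hK0, hg1, hg2⟩ := hg.exists_lipschitzWith
  have hK : (0 : ℝ) < K := by exact_mod_cast hK0
  obtain ⟨C, hC⟩ := F.exists_countingFunction_mul_le hm hμ₀ hK
  have hback : (deformedMeasure μ₀ g).map g = μ₀ := by
    rw [deformedMeasure, Measure.map_map g.continuous.measurable g.symm.continuous.measurable]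
    simp
  have hup : ∀ lam, (countingFunction lam (deformedMeasure μ₀ g)).toNat ≤
      (countingFunction (K * lam) μ₀).toNat := by
    intro lam
    have h1 := hasPosSpace_countingFunction (deformedMeasure μ₀ g) lam
    have h2 := h1.comp_homeomorph hg2 hK0
    rw [Homeomorph.symm_symm, hback] at h2
    exact h2.le_countingFunction
  have hdown : ∀ lam, (countingFunction lam μ₀).toNat ≤
      (countingFunction (K * lam) (deformedMeasure μ₀ g)).toNat := by
    intro lam
    have h1 : HasPosSpace (deformedMeasure μ₀ g) _ _ :=
      (hasPosSpace_countingFunction μ₀ lam).comp_homeomorph hg1 hK0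
    exact h1.le_countingFunction
  -- `C` is only a natural number, so 1 is added to make it invertible.
  have hC0 : (0 : ℝ) < C + 1 := by positivity
  refine ⟨(C + 1 : ℝ)⁻¹, C + 1, by positivity, hC0, fun lam _ => ⟨?_, ?_⟩⟩
  · rw [inv_mul_le_iff₀ hC0]
    -- The lower bound applies doubling at `lam / K`: N(λ, μ₀) ≤ C · N(λ/K, μ₀) ≤ C · N(λ, μ).
    have h1 := hC ((K : ℝ)⁻¹ * lam)
    have h2 := hdown ((K : ℝ)⁻¹ * lam)
    rw [mul_inv_cancel_left₀ hK.ne'] at h1 h2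
    have h3 : (countingFunction lam μ₀).toNat ≤
        (C + 1) * (countingFunction lam (deformedMeasure μ₀ g)).toNat :=
      h1.trans (Nat.mul_le_mul (Nat.le_succ C) h2)
    exact_mod_cast h3
  · have h3 : (countingFunction lam (deformedMeasure μ₀ g)).toNat ≤
        (C + 1) * (countingFunction lam μ₀).toNat :=
      (hup lam).trans ((hC lam).trans (Nat.mul_le_mul_right _ (Nat.le_succ C)))
    exact_mod_cast h3
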